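/- Let $n\ge 2$ and let $G=\mathrm{Isom}^+(\mathbb H^n)$ be the group of orientation preserving isometries of hyperbolic $n$-space. A \emph{body} is a nonempty compact connected subset of $\mathbb H^n$ that is the closure of its interior; a \emph{packing} is a collection of bodies with pairwise disjoint interiors; a \emph{tiling} is a packing by homeomorphic images of the closed unit ball (its \emph{tiles}) whose union is $\mathbb H^n$. We write $p\in\mathcal P$ if $p$ lies in some body of $\mathcal P$, and $\mathcal P\cap A$ for the part of $A$ covered by the bodies of $\mathcal P$. Spaces of packings carry the Borel structure of the topology of uniform convergence (of the individual bodies) on compact subsets of $\mathbb H^n$, i.e. the Fell (hit-or-miss) topology over the space of nonempty compact sets with its Hausdorff topology. Let $\Sigma$ be a $G$-invariant space of packings of $\mathbb H^n$ (for example a compact one) and let $\mu$ be a $G$-invariant Borel probability measure on $\Sigma$. Its average density is $D(\mu)=\mu\{\mathcal P\in\Sigma: O\in\mathcal P\}$, where $O$ is the origin of $\mathbb H^n$. (a) Let $\phi$ be a Borel measurable $G$-equivariant map from $\Sigma$ to a space of tilings of $\mathbb H^n$ (for example, the Voronoi tilings when these are tilings in the above sense). Assume that for $\mu$-almost every $\mathcal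 P$ distinct tiles of $\phi(\mathcal P)$ meet in sets of volume zero. For $p\in\mathbb H^n$ let $\tau_p(\mathcal P)$ denote a tile of $\phi(\mathcal P)$ containing $p$ (chosen arbitrarily if there are several). Then for every $p\in\mathbb H^n$ the integrand below is $\mu$-integrable and $$D(\mu)=\int_\Sigma \frac{\mathrm{vol}[\mathcal P\cap\tau_p(\mathcal P)]}{\mathrm{vol}[\tau_p(\mathcal P)]}\,d\mu(\mathcal P).$$ (b) Let $\mathcal P$ be a periodic packing, i.e. its symmetry group $\Gamma_{\mathcal P}=\{g\in G: g\mathcal P=\mathcal P\}$ is cocompact in $G$, and suppose that $\mu$-almost every element of $\Sigma$ lies in the orbit $G\mathcal P$. Then for every (measurable, non-null) fundamental domain $F$ of $\Gamma_{\mathcal P}$ in $\mathbb H^n$, $$D(\mu)=\frac{\mathrm{vol}[\mathcal P\cap F]}{\mathrm{vol}[F]}.$$ -/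

import Mathlib

open Set MeasureTheory TopologicalSpace

noncomputable section

namespace HypPacking

/-- The Lorentz form `x₁ y₁ + ⋯ + xₙ yₙ - x₀ y₀` on `ℝⁿ⁺¹`. -/
def lorentz {n : ℕ} (x y : Fin (n + 1) → ℝ) : ℝ :=
  (∑ i : Fin n, x i.succ * y i.succ) - x 0 * y 0

/-- Hyperbolic `n`-space of curvature `-1`: the upper sheet of the hyperboloid
`x₁² + ⋯ + xₙ² - x₀² = -1`. -/
def Hyp (n : ℕ) : Type := {x : Fin (n + 1) → ℝ // lorentz x x = -1 ∧ 0 < x 0}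

namespace Hyp

variable {n : ℕ}

/-- The topology of hyperbolic space (the one of the hyperbolic distance `hdist` below). -/
instance : TopologicalSpace (Hyp n) :=
  inferInstanceAs (TopologicalSpace {x : Fin (n + 1) → ℝ // lorentz x x = -1 ∧ 0 < x 0})

instance : MeasurableSpace (Hyp n) := borel (Hyp n)

instance : BorelSpace (Hyp n) := ⟨rfl⟩

/-- The hyperbolic distance: `cosh d(x, y) = -⟨x, y⟩`. -/
def hdist (x y : Hyp n) : ℝ := Real.arcosh (-lorentz x.1 y.1)

/-- The distinguished origin `(1, 0, …, 0)`. -/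
def origin : Hyp n :=
  ⟨fun i => if i = 0 then 1 else 0, by simp [lorentz, Fin.succ_ne_zero], by simp⟩

/-- The hyperbolic (Riemannian) volume. In the polar coordinates `y = r • x` of the solid cone
over the hyperboloid, with `x` in `Hyp n` and `r > 0`, Lebesgue measure is
`dy = rⁿ dr dvol(x)`; so `vol E` is `n + 1` times the Lebesgue measure of the set of all `r • x`
with `x ∈ E` and `0 < r < 1` (compare `MeasureTheory.Measure.toSphere` for the sphere). -/
def vol : Measure (Hyp n) :=
  ((n : ENNReal) + 1) •
    ((volume : Measure (Fin (n + 1) → ℝ)).comap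
      (fun z : Hyp n × Ioo (0 : ℝ) 1 => (z.2 : ℝ) • z.1.1)).fst

/-- The cone parametrization is a measurable embedding, so that `vol` is what it should be. -/
theorem measurableEmbedding_cone :
    MeasurableEmbedding (fun z : Hyp n × Ioo (0 : ℝ) 1 => (z.2 : ℝ) • z.1.1) := by
  have hcl : IsClosed {x : Fin (n + 1) → ℝ | lorentz x x = -1 ∧ 0 ≤ x 0} := by
    apply IsClosed.inter
    · exact isClosed_eq (by unfold lorentz; fun_prop) continuous_const
    · exact isClosed_le continuous_const (continuous_apply 0)
  have heq : {x : Fin (n + 1) → ℝ | lorentz x x = -1 ∧ 0 ≤ x 0} =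
      {x : Fin (n + 1) → ℝ | lorentz x x = -1 ∧ 0 < x 0} := by
    ext x
    refine and_congr_right fun hx => ⟨fun h => lt_of_le_of_ne h fun h0 => ?_, le_of_lt⟩
    unfold lorentz at hx
    rw [← h0] at hx
    have : 0 ≤ ∑ i : Fin n, x i.succ * x i.succ := Finset.sum_nonneg fun i _ => mul_self_nonneg _
    linarith
  rw [heq] at hcl
  have : PolishSpace (Hyp n) := hcl.polishSpace
  have : PolishSpace (Ioo (0 : ℝ) 1) := isOpen_Ioo.polishSpace
  have hc : Continuous (fun z : Hyp n × Ioo (0 : ℝ) 1 => (z.2 : ℝ) • z.1.1) :=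
    (continuous_subtype_val.comp continuous_snd).smul
      (continuous_subtype_val.comp continuous_fst)
  refine hc.measurableEmbedding ?_
  rintro ⟨x, r⟩ ⟨y, t⟩ h
  change (r : ℝ) • x.1 = (t : ℝ) • y.1 at h
  have hl : ∀ (c : ℝ) (v : Fin (n + 1) → ℝ), lorentz (c • v) (c • v) = c ^ 2 * lorentz v v := by
    intro c v
    simp only [lorentz, Pi.smul_apply, smul_eq_mul, mul_sub, Finset.mul_sum]
    congr 1
    · exact Finset.sum_congr rfl fun i _ => by ring
    · ring
  have h2 : (r : ℝ) ^ 2 = (t : ℝ) ^ 2 := by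
    have := congrArg (fun v => lorentz v v) h
    simp only [hl, x.2.1, y.2.1] at this
    linarith
  have h3 : (r : ℝ) = t := by
    exact (pow_left_inj₀ r.2.1.le t.2.1.le two_ne_zero).1 h2
  have hr : r = t := Subtype.ext h3
  subst hr
  have hxy : x.1 = y.1 := smul_right_injective _ r.2.1.ne' h
  exact Prod.ext (Subtype.ext hxy) rfl

theorem vol_apply {E : Set (Hyp n)} (hE : MeasurableSet E) :
    vol E = ((n : ENNReal) + 1) *
      volume {y : Fin (n + 1) → ℝ | ∃ x ∈ E, ∃ r ∈ Ioo (0 : ℝ) 1, y = r • x.1} := by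
  have h : (fun z : Hyp n × Ioo (0 : ℝ) 1 => (z.2 : ℝ) • z.1.1) '' (Prod.fst ⁻¹' E) =
      {y : Fin (n + 1) → ℝ | ∃ x ∈ E, ∃ r ∈ Ioo (0 : ℝ) 1, y = r • x.1} := by
    ext y
    constructor
    · rintro ⟨⟨x, r⟩, hx, rfl⟩
      exact ⟨x, hx, r, r.2, rfl⟩
    · rintro ⟨x, hx, r, hr, rfl⟩
      exact ⟨(x, ⟨r, hr⟩), hx, rfl⟩
  rw [vol, Measure.smul_apply, Measure.fst_apply hE, measurableEmbedding_cone.comap_apply, h,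
    smul_eq_mul]

end Hyp

open Hyp

/-- The group `Isom⁺(Hⁿ)` of orientation preserving isometries of hyperbolic space, as a group of
permutations of `Hyp n`: every isometry of the hyperboloid is the restriction of a unique linear
map of `ℝⁿ⁺¹`, of determinant `1` or `-1`, and preserves the orientation when the determinant
is `1`. -/
def IsomPlus (n : ℕ) : Subgroup (Equiv.Perm (Hyp n)) where
  carrier := {g | (∀ x y, hdist (g x) (g y) = hdist x y) ∧
    ∃ A : (Fin (n + 1) → ℝ) →ₗ[ℝ] (Fin (n + 1) → ℝ), LinearMap.det A = 1 ∧
      ∀ x : Hyp n, (g x).1 = A x.1}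
  one_mem' := ⟨fun _ _ => rfl, LinearMap.id, by simp, fun _ => rfl⟩
  mul_mem' := by
    rintro g h ⟨hg, A, hA, hgA⟩ ⟨hh, B, hB, hhB⟩
    refine ⟨fun x y => ?_, A.comp B, ?_, fun x => ?_⟩
    · rw [Equiv.Perm.mul_apply, Equiv.Perm.mul_apply, hg, hh]
    · rw [LinearMap.det_comp, hA, hB, one_mul]
    · rw [Equiv.Perm.mul_apply, hgA, hhB, LinearMap.comp_apply]
  inv_mem' := by
    rintro g ⟨hg, A, hA, hgA⟩
    obtain ⟨e, he⟩ : ∃ e : (Fin (n + 1) → ℝ) ≃ₗ[ℝ] (Fin (n + 1) → ℝ), e.toLinearMap = A :=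
      ⟨A.equivOfDetNeZero (by rw [hA]; exact one_ne_zero), rfl⟩
    have hinv : ∀ x, g (g⁻¹ x) = x := fun x => g.apply_symm_apply x
    refine ⟨fun x y => ?_, e.symm.toLinearMap, ?_, fun x => ?_⟩
    · rw [← hg, hinv, hinv]
    · have h := LinearEquiv.det_symm_mul_det e
      rwa [he, hA, mul_one] at h
    · rw [LinearEquiv.coe_coe, LinearEquiv.eq_symm_apply]
      change e.toLinearMap _ = _
      rw [he, ← hgA, hinv]

section Action

variable {n : ℕ}

theorem continuous_isomPlus_smul (g : IsomPlus n) : Continuous (fun x : Hyp n => g • x) := by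
  obtain ⟨g, -, A, -, hA⟩ := g
  refine Continuous.subtype_mk (p := fun x : Fin (n + 1) → ℝ => lorentz x x = -1 ∧ 0 < x 0)
    (f := fun x : Hyp n => (g x).1) ?_ (fun x => (g x).2)
  have h : (fun x : Hyp n => (g x).1) = fun x => A x.1 := funext hA
  rw [h]
  exact A.continuous_of_finiteDimensional.comp continuous_subtype_val

/-- An orientation preserving isometry as a homeomorphism. -/
def isomHomeo (g : IsomPlus n) : Hyp n ≃ₜ Hyp n where
  toEquiv := MulAction.toPerm g
  continuous_toFun := continuous_isomPlus_smul g
  continuous_invFun := continuous_isomPlus_smul g⁻¹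

/-- The group acts on nonempty compact sets by taking images. -/
instance : MulAction (IsomPlus n) (NonemptyCompacts (Hyp n)) where
  smul g K := K.map (fun x => g • x) (continuous_isomPlus_smul g)
  one_smul K := by
    apply SetLike.coe_injective
    change (fun x : Hyp n => (1 : IsomPlus n) • x) '' (K : Set (Hyp n)) = K
    simp
  mul_smul g h K := by
    apply SetLike.coe_injective
    change (fun x : Hyp n => (g * h) • x) '' (K : Set (Hyp n)) =
      (fun x : Hyp n => g • x) '' ((fun x : Hyp n => h • x) '' (K : Set (Hyp n)))
    rw [image_image]
    simp only [mul_smul]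

theorem coe_smul_compacts (g : IsomPlus n) (K : NonemptyCompacts (Hyp n)) :
    ((g • K : NonemptyCompacts (Hyp n)) : Set (Hyp n)) = (isomHomeo g) '' (K : Set (Hyp n)) := rfl

end Action

/-- A body: a (nonempty) compact connected set that is the closure of its interior. -/
def IsBody {n : ℕ} (K : NonemptyCompacts (Hyp n)) : Prop :=
  IsConnected (K : Set (Hyp n)) ∧ closure (interior (K : Set (Hyp n))) = K

/-- A packing of `Hⁿ`: a collection of bodies with pairwise disjoint interiors. -/
@[ext]
structure Packing (n : ℕ) where
  bodies : Set (NonemptyCompacts (Hyp n))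
  isBody : ∀ K ∈ bodies, IsBody K
  disjoint : bodies.Pairwise fun K L =>
    Disjoint (interior (K : Set (Hyp n))) (interior (L : Set (Hyp n)))

namespace Packing

variable {n : ℕ}

/-- The part of `Hⁿ` covered by the bodies of the packing. -/
def covered (P : Packing n) : Set (Hyp n) := ⋃ K ∈ P.bodies, (K : Set (Hyp n))

/-- Isometries act on packings by moving every body. -/
instance : MulAction (IsomPlus n) (Packing n) where
  smul g P :=
    { bodies := (fun K => g • K) '' P.bodies
      isBody := by
        rintro _ ⟨K, hK, rfl⟩
        obtain ⟨h1, h2⟩ := P.isBody K hK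
        refine ⟨?_, ?_⟩
        · exact h1.image _ (continuous_isomPlus_smul g).continuousOn
        · change closure (interior ((isomHomeo g) '' (K : Set (Hyp n)))) = (isomHomeo g) '' (K : Set (Hyp n))
          rw [← (isomHomeo g).image_interior, ← (isomHomeo g).image_closure, h2]
      disjoint := by
        rintro _ ⟨K, hK, rfl⟩ _ ⟨L, hL, rfl⟩ hne
        have hKL : K ≠ L := fun h => hne (by rw [h])
        change Disjoint (interior ((isomHomeo g) '' (K : Set (Hyp n))))
          (interior ((isomHomeo g) '' (L : Set (Hyp n))))
        rw [← (isomHomeo g).image_interior, ← (isomHomeo g).image_interior,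
          disjoint_image_iff (isomHomeo g).injective]
        exact P.disjoint hK hL hKL }
  one_smul P := by
    apply Packing.ext
    change (fun K => (1 : IsomPlus n) • K) '' P.bodies = P.bodies
    simp
  mul_smul g h P := by
    apply Packing.ext
    change (fun K => (g * h) • K) '' P.bodies =
      (fun K => g • K) '' ((fun K => h • K) '' P.bodies)
    rw [image_image]
    simp only [mul_smul]

/-- The topology of uniform convergence on compact subsets of `Hⁿ`, the individual bodies being
kept apart: `P` is close to `Q` when, within a bounded region, every body of `P` is Hausdorff close
to a body of `Q` and conversely. It is the Fell topology over the space of nonempty compact sets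
with the Hausdorff metric topology. -/
instance : TopologicalSpace (Packing n) :=
  generateFrom
    ({A | ∃ U : Set (NonemptyCompacts (Hyp n)), IsOpen U ∧
        A = {P : Packing n | (P.bodies ∩ U).Nonempty}} ∪
     {A | ∃ C : Set (NonemptyCompacts (Hyp n)), IsCompact C ∧
        A = {P : Packing n | P.bodies ∩ C = ∅}})

instance : MeasurableSpace (Packing n) := borel (Packing n)

instance : BorelSpace (Packing n) := ⟨rfl⟩

/-- A tiling: a packing by homeomorphic images of the closed unit ball whose union is the whole
space. -/
def IsTiling (T : Packing n) : Prop :=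
  (∀ K ∈ T.bodies,
    Nonempty ((K : Set (Hyp n)) ≃ₜ Metric.closedBall (0 : EuclideanSpace ℝ (Fin n)) 1)) ∧
  T.covered = univ

/-- The symmetry group of a packing. -/
abbrev symmetryGroup (P : Packing n) : Subgroup (IsomPlus n) :=
  MulAction.stabilizer (IsomPlus n) P

/-- A packing is periodic if its symmetry group is cocompact in the isometry group, that is, if the
translates of some compact subset of `Hⁿ` under the symmetry group cover `Hⁿ`. -/
def IsPeriodic (P : Packing n) : Prop :=
  ∃ C : Set (Hyp n), IsCompact C ∧ ∀ x : Hyp n, ∃ g : P.symmetryGroup, g • x ∈ C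

/-- The function `F_p`: the indicator function of the set of all packings that have a body
containing `p`. -/
def coverIndicator (p : Hyp n) (P : Packing n) : ℝ :=
  indicator {Q : Packing n | p ∈ Q.covered} (fun _ => (1 : ℝ)) P

end Packing

/-- The average density `D(μ)` of an invariant measure `μ` on an invariant space of packings. -/
def averageDensity {n : ℕ} {S : SubMulAction (IsomPlus n) (Packing n)} (μ : Measure S) : ℝ :=
  ∫ P : S, Packing.coverIndicator origin (P : Packing n) ∂μ

end HypPacking

end

/-! Part (a) is mass transport. Let every point covered by the packing spread a unit mass uniformly
over its tile. The expected mass leaving `p` is the probability that `p` is covered; the expected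
mass arriving at `p` is the expected covered fraction of the tile at `p`. By Tonelli and the
invariance of `μ` these agree (`mass_transport`) as soon as any two points can be swapped by an
orientation preserving isometry (`exists_swap`): reflect in the perpendicular bisector, then correct
the determinant by a reflection fixing both points, which exists because `n ≥ 2`. Two technical
points remain. The kernel must be jointly measurable; this holds because a nonempty open set lies in
at most one body, so a countable basis labels the bodies measurably (`isClosed_bodyOver_subset`).
And the tile at `p` must be almost surely unique, which follows by Fubini and invariance from the
overlaps having volume zero (`ae_not_isMultiple`).

Part (b) needs no description of the invariant measure on the orbit. Replace the indicator function
of the covered set by its iterated averages over balls of a fixed large radius. Averaging commutes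
with isometries, preserves the mean over `μ` at each point, and, its kernel being symmetric,
preserves the integral over `F`. For a periodic packing every ball centre can be moved into a
compact set, where all the balls contain a common ball; by Doeblin's argument the oscillation of the
`k`-th average is at most `(1 - δ) ^ k`. So the averages converge uniformly to the density in `F`,
for every packing in the orbit, while their mean over `μ` stays equal to the average density. -/

noncomputable section

open Filter Topology
open scoped ENNReal

namespace HypPacking

variable {n : ℕ}

/-! ### Lorentz geometry: reflections and isometries swapping two points. -/

section Lorentz

theorem lorentz_comm (x y : Fin (n + 1) → ℝ) : lorentz x y = lorentz y x := by
  simp only [lorentz, mul_comm]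

theorem lorentz_add_left (x y z : Fin (n + 1) → ℝ) :
    lorentz (x + y) z = lorentz x z + lorentz y z := by
  simp only [lorentz, Pi.add_apply, add_mul, Finset.sum_add_distrib]
  ring

theorem lorentz_smul_left (c : ℝ) (x y : Fin (n + 1) → ℝ) :
    lorentz (c • x) y = c * lorentz x y := by
  simp only [lorentz, Pi.smul_apply, smul_eq_mul, mul_sub, Finset.mul_sum, mul_assoc]

theorem lorentz_add_right (x y z : Fin (n + 1) → ℝ) :
    lorentz x (y + z) = lorentz x y + lorentz x z := by
  rw [lorentz_comm, lorentz_add_left, lorentz_comm y, lorentz_comm z]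

theorem lorentz_smul_right (c : ℝ) (x y : Fin (n + 1) → ℝ) :
    lorentz x (c • y) = c * lorentz x y := by
  rw [lorentz_comm, lorentz_smul_left, lorentz_comm]

theorem continuous_lorentz :
    Continuous fun p : (Fin (n + 1) → ℝ) × (Fin (n + 1) → ℝ) => lorentz p.1 p.2 := by
  unfold lorentz
  fun_prop

/-- The linear functional `z ↦ ⟨z, w⟩`. -/
def lorentzDual (w : Fin (n + 1) → ℝ) : Module.Dual ℝ (Fin (n + 1) → ℝ) where
  toFun z := lorentz z w
  map_add' x y := lorentz_add_left x y w
  map_smul' c x := lorentz_smul_left c x w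

@[simp]
theorem lorentzDual_apply (w z : Fin (n + 1) → ℝ) : lorentzDual w z = lorentz z w := rfl

/-- A nonzero vector orthogonal to a timelike one is spacelike. -/
theorem lorentz_self_pos_of_orthogonal {u w : Fin (n + 1) → ℝ} (hu : lorentz u u < 0)
    (hwu : lorentz w u = 0) (hw : w ≠ 0) : 0 < lorentz w w := by
  by_contra! hle
  have hcs := Finset.sum_mul_sq_le_sq_mul_sq Finset.univ (fun i : Fin n => w i.succ)
    (fun i => u i.succ)
  have hs : 0 ≤ ∑ i : Fin n, w i.succ ^ 2 := Finset.sum_nonneg fun i _ => sq_nonneg _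
  have hs' : 0 ≤ ∑ i : Fin n, u i.succ ^ 2 := Finset.sum_nonneg fun i _ => sq_nonneg _
  simp only [lorentz, ← sq] at hu hwu hle
  have h1 : ∑ i : Fin n, w i.succ * u i.succ = w 0 * u 0 := by linarith
  rw [h1] at hcs
  have h0 : w 0 = 0 := by
    by_contra h
    have : 0 < w 0 ^ 2 := by positivity
    nlinarith [mul_pos this (sub_pos.2 hu)]
  have h2 : ∑ i : Fin n, w i.succ ^ 2 = 0 := by
    rw [h0] at hle
    linarith
  rw [Finset.sum_eq_zero_iff_of_nonneg fun i _ => sq_nonneg _] at h2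
  refine hw (funext fun i => ?_)
  refine Fin.cases h0 (fun j => ?_) i
  simpa using h2 j (Finset.mem_univ j)

/-- Reversed Cauchy–Schwarz, deduced from the ordinary inequality for the spatial coordinates. It
places the argument of `arcosh` in the range where that function is injective. -/
theorem Hyp.one_le_neg_lorentz (x y : Hyp n) : 1 ≤ -lorentz x.1 y.1 := by
  obtain ⟨x, hx, hx0⟩ := x
  obtain ⟨y, hy, hy0⟩ := y
  have hcs := Finset.sum_mul_sq_le_sq_mul_sq Finset.univ (fun i : Fin n => x i.succ)
    (fun i => y i.succ)
  simp only [lorentz, ← sq] at hx hy ⊢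
  have h1 : ∑ i : Fin n, x i.succ ^ 2 = x 0 ^ 2 - 1 := by linarith
  have h2 : ∑ i : Fin n, y i.succ ^ 2 = y 0 ^ 2 - 1 := by linarith
  have hs : 0 ≤ ∑ i : Fin n, x i.succ ^ 2 := Finset.sum_nonneg fun i _ => sq_nonneg _
  have hs' : 0 ≤ ∑ i : Fin n, y i.succ ^ 2 := Finset.sum_nonneg fun i _ => sq_nonneg _
  rw [h1, h2] at hcs
  have hx1 : 1 ≤ x 0 := by nlinarith
  have hy1 : 1 ≤ y 0 := by nlinarith
  have hxy : 0 ≤ x 0 * y 0 - 1 := by nlinarith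
  have := abs_le_of_sq_le_sq (a := ∑ i : Fin n, x i.succ * y i.succ) (b := x 0 * y 0 - 1)
    (by nlinarith [sq_nonneg (x 0 - y 0)]) hxy
  linarith [le_abs_self (∑ i : Fin n, x i.succ * y i.succ)]

theorem Hyp.lorentz_neg (x y : Hyp n) : lorentz x.1 y.1 < 0 := by
  linarith [Hyp.one_le_neg_lorentz x y]

/-- The Lorentz reflection in the hyperplane orthogonal to `w`. -/
def reflection (w : Fin (n + 1) → ℝ) : (Fin (n + 1) → ℝ) →ₗ[ℝ] (Fin (n + 1) → ℝ) :=
  LinearMap.transvection ((-2 / lorentz w w) • lorentzDual w) w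

theorem reflection_apply (w z : Fin (n + 1) → ℝ) :
    reflection w z = z + (-2 / lorentz w w * lorentz z w) • w := rfl

theorem det_reflection {w : Fin (n + 1) → ℝ} (hw : lorentz w w ≠ 0) :
    LinearMap.det (reflection w) = -1 := by
  rw [reflection, LinearMap.transvection.det]
  simp only [LinearMap.smul_apply, lorentzDual_apply, smul_eq_mul]
  field_simp
  norm_num

theorem lorentz_reflection {w : Fin (n + 1) → ℝ} (hw : lorentz w w ≠ 0)
    (x y : Fin (n + 1) → ℝ) : lorentz (reflection w x) (reflection w y) = lorentz x y := by
  simp only [reflection_apply, lorentz_add_left, lorentz_add_right, lorentz_smul_left,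
    lorentz_smul_right, lorentz_comm w y]
  field_simp
  ring

theorem reflection_reflection {w : Fin (n + 1) → ℝ} (hw : lorentz w w ≠ 0)
    (x : Fin (n + 1) → ℝ) : reflection w (reflection w x) = x := by
  simp only [reflection_apply, lorentz_add_left, lorentz_smul_left, add_assoc, ← add_smul]
  rw [add_eq_left]
  convert zero_smul ℝ w
  field_simp
  ring

/-- Points of one sheet have negative product. If `z` were sent to the lower sheet, minus its image
would have negative product with `y`, the image of `x`; but that product is `-⟨z, x⟩ > 0`. -/
theorem reflection_mem_hyp {w : Fin (n + 1) → ℝ} (hw : lorentz w w ≠ 0) {x y : Hyp n}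
    (hxy : reflection w x.1 = y.1) (z : Hyp n) :
    lorentz (reflection w z.1) (reflection w z.1) = -1 ∧ 0 < reflection w z.1 0 := by
  have h1 : lorentz (reflection w z.1) (reflection w z.1) = -1 := by
    rw [lorentz_reflection hw, z.2.1]
  refine ⟨h1, ?_⟩
  by_contra! hle
  have hlt : reflection w z.1 0 < 0 := by
    refine lt_of_le_of_ne hle fun h0 => ?_
    simp only [lorentz, h0] at h1
    have : 0 ≤ ∑ i : Fin n, reflection w z.1 i.succ * reflection w z.1 i.succ :=
      Finset.sum_nonneg fun i _ => mul_self_nonneg _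
    linarith
  have h2 := Hyp.lorentz_neg ⟨(-1 : ℝ) • reflection w z.1, by
    rw [lorentz_smul_left, lorentz_smul_right, h1]; norm_num, by
    simpa using hlt⟩ y
  rw [← hxy, lorentz_smul_left, lorentz_reflection hw] at h2
  linarith [Hyp.lorentz_neg z x]

/-- A reflection preserving the upper sheet, as a permutation of hyperbolic space. -/
def hypReflection {w : Fin (n + 1) → ℝ} (hw : lorentz w w ≠ 0) {x y : Hyp n}
    (hxy : reflection w x.1 = y.1) : Equiv.Perm (Hyp n) :=
  Function.Involutive.toPerm (fun z => ⟨reflection w z.1, reflection_mem_hyp hw hxy z⟩)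
    fun z => Subtype.ext (reflection_reflection hw z.1)

/-- Any two points of hyperbolic space of dimension at least two are swapped by an orientation
preserving isometry. -/
theorem exists_swap (hn : 2 ≤ n) (x y : Hyp n) : ∃ g : IsomPlus n, g • x = y ∧ g • y = x := by
  rcases eq_or_ne x y with rfl | hne
  · exact ⟨1, one_smul _ _, one_smul _ _⟩
  -- The difference `x - y` is orthogonal to the timelike vector `x + y`, hence spacelike, and its
  -- reflection swaps `x` and `y`.
  set v : Fin (n + 1) → ℝ := x.1 + (-1 : ℝ) • y.1 with hv
  have hv0 : v ≠ 0 := fun h => hne (Subtype.ext (by simpa [hv, add_neg_eq_zero] using h))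
  have hvv : 0 < lorentz v v := by
    refine lorentz_self_pos_of_orthogonal (u := x.1 + y.1) ?_ ?_ hv0
    · simp only [lorentz_add_left, lorentz_add_right, x.2.1, y.2.1]
      linarith [Hyp.lorentz_neg x y, Hyp.lorentz_neg y x]
    · simp only [hv, lorentz_add_left, lorentz_add_right, lorentz_smul_left, x.2.1, y.2.1]
      linarith [lorentz_comm x.1 y.1]
  have hvx : reflection v x.1 = y.1 := by
    have h1 : -2 / lorentz v v * lorentz x.1 v = -1 := by
      have h2 : lorentz v v = 2 * lorentz x.1 v := by
        simp only [hv, lorentz_add_left, lorentz_add_right, lorentz_smul_left, lorentz_smul_right,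
          x.2.1, y.2.1]
        linarith [lorentz_comm x.1 y.1]
      have h3 : lorentz x.1 v ≠ 0 := fun h => by rw [h] at h2; linarith
      rw [h2]
      field_simp
    rw [reflection_apply, h1, hv]
    module
  have hvy : reflection v y.1 = x.1 := by rw [← hvx, reflection_reflection hvv.ne']
  -- Two linear conditions in dimension `n + 1 ≥ 3` have a nonzero solution. The reflection in it
  -- fixes `x` and `y` and restores the orientation.
  obtain ⟨w, hwk, hw0⟩ : ∃ w ∈ LinearMap.ker ((lorentzDual x.1).prod (lorentzDual y.1)), w ≠ 0 := by
    refine (Submodule.ne_bot_iff _).1 (LinearMap.ker_ne_bot_of_finrank_lt ?_)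
    simp
    omega
  simp only [LinearMap.mem_ker, LinearMap.prod_apply, Function.prod_apply, lorentzDual_apply,
    Prod.mk_eq_zero] at hwk
  have hww : 0 < lorentz w w :=
    lorentz_self_pos_of_orthogonal (by rw [x.2.1]; norm_num) hwk.1 hw0
  have hwx : reflection w x.1 = x.1 := by
    rw [reflection_apply, lorentz_comm x.1 w, hwk.1]; simp
  have hwy : reflection w y.1 = y.1 := by
    rw [reflection_apply, lorentz_comm y.1 w, hwk.2]; simp
  refine ⟨⟨hypReflection hww.ne' hwx * hypReflection hvv.ne' hvx, fun a b => ?_,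
    (reflection w).comp (reflection v), ?_, fun a => rfl⟩, Subtype.ext ?_, Subtype.ext ?_⟩
  · change Real.arcosh (-lorentz (reflection w (reflection v a.1))
      (reflection w (reflection v b.1))) = _
    rw [lorentz_reflection hww.ne', lorentz_reflection hvv.ne']
    rfl
  · rw [LinearMap.det_comp, det_reflection hww.ne', det_reflection hvv.ne']
    norm_num
  · change reflection w (reflection v x.1) = y.1
    rw [hvx, hwy]
  · change reflection w (reflection v y.1) = x.1
    rw [hvy, hwx]

theorem lorentz_smul_smul (g : IsomPlus n) (x y : Hyp n) :
    lorentz (g • x).1 (g • y).1 = lorentz x.1 y.1 := by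
  have h := g.2.1 x y
  exact neg_injective (Real.arcosh_injOn (Hyp.one_le_neg_lorentz _ _)
    (Hyp.one_le_neg_lorentz _ _) h)

end Lorentz

/-! ### Topology of the hyperboloid. -/

section Topology

namespace Hyp

theorem isClosed_range_val :
    IsClosed {x : Fin (n + 1) → ℝ | lorentz x x = -1 ∧ 0 < x 0} := by
  have heq : {x : Fin (n + 1) → ℝ | lorentz x x = -1 ∧ 0 < x 0} =
      {x : Fin (n + 1) → ℝ | lorentz x x = -1 ∧ 0 ≤ x 0} := by
    ext x
    refine and_congr_right fun hx => ⟨le_of_lt, fun h => lt_of_le_of_ne h fun h0 => ?_⟩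
    simp only [lorentz, ← h0] at hx
    have : 0 ≤ ∑ i : Fin n, x i.succ * x i.succ := Finset.sum_nonneg fun i _ => mul_self_nonneg _
    linarith
  rw [heq]
  exact (isClosed_eq (by unfold lorentz; fun_prop) continuous_const).inter
    (isClosed_le continuous_const (continuous_apply 0))

theorem isClosedEmbedding_val :
    IsClosedEmbedding (fun x : Hyp n => (x.1 : Fin (n + 1) → ℝ)) :=
  isClosed_range_val.isClosedEmbedding_subtypeVal

theorem continuous_val : Continuous (fun x : Hyp n => (x.1 : Fin (n + 1) → ℝ)) :=
  isClosedEmbedding_val.continuous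

instance : T2Space (Hyp n) := isClosedEmbedding_val.isEmbedding.t2Space

instance : SecondCountableTopology (Hyp n) :=
  isClosedEmbedding_val.isEmbedding.secondCountableTopology

instance : LocallyCompactSpace (Hyp n) := isClosedEmbedding_val.locallyCompactSpace

instance : Nonempty (Hyp n) := ⟨origin⟩

end Hyp

instance : ContinuousConstSMul (IsomPlus n) (Hyp n) := ⟨continuous_isomPlus_smul⟩

end Topology

/-! ### The volume is invariant, finite on compact sets and positive on open sets. -/

section Volume

namespace Hyp

/-- The part of the solid cone over `E` below the hyperboloid. -/
def cone (E : Set (Hyp n)) : Set (Fin (n + 1) → ℝ) :=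
  {y | ∃ x ∈ E, ∃ r ∈ Ioo (0 : ℝ) 1, y = r • x.1}

/-- An isometry is the restriction of a linear map of determinant one, which carries solid cones to
solid cones and preserves Lebesgue measure. -/
instance : SMulInvariantMeasure (IsomPlus n) (Hyp n) vol := by
  refine ⟨fun g E hE => ?_⟩
  obtain ⟨A, hA, hgA⟩ := g.2.2
  have hcone : A '' cone ((fun x => g • x) ⁻¹' E) = cone E := by
    ext y
    constructor
    · rintro ⟨_, ⟨x, hx, r, hr, rfl⟩, rfl⟩
      exact ⟨g • x, hx, r, hr, by rw [map_smul, ← hgA]; rfl⟩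
    · rintro ⟨x, hx, r, hr, rfl⟩
      refine ⟨_, ⟨g⁻¹ • x, by simpa using hx, r, hr, rfl⟩, ?_⟩
      have h : (g • g⁻¹ • x).1 = A (g⁻¹ • x).1 := hgA (g⁻¹ • x)
      rw [map_smul, ← h, smul_inv_smul]
  rw [vol_apply hE, vol_apply (hE.preimage (continuous_isomPlus_smul g).measurable)]
  change _ * volume (cone ((fun x => g • x) ⁻¹' E)) = _ * volume (cone E)
  rw [← hcone, Measure.addHaar_image_linearMap, hA]
  simp

instance : IsFiniteMeasureOnCompacts (vol : Measure (Hyp n)) := by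
  refine ⟨fun K hK => ?_⟩
  rw [vol_apply hK.measurableSet]
  refine ENNReal.mul_lt_top (by finiteness) ?_
  have hc : IsCompact ((fun p : Hyp n × ℝ => p.2 • p.1.1) '' (K ×ˢ Icc (0 : ℝ) 1)) :=
    (hK.prod isCompact_Icc).image
      (continuous_snd.smul (continuous_val.comp continuous_fst))
  refine lt_of_le_of_lt (measure_mono ?_) hc.measure_lt_top
  rintro _ ⟨x, hx, r, hr, rfl⟩
  exact ⟨(x, r), ⟨hx, hr.1.le, hr.2.le⟩, rfl⟩

instance : Measure.IsOpenPosMeasure (vol : Measure (Hyp n)) := by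
  refine ⟨fun U hU ⟨x, hx⟩ => ?_⟩
  rw [vol_apply hU.measurableSet]
  refine mul_ne_zero (by simp) (ne_of_gt ?_)
  obtain ⟨U', hU', rfl⟩ := isClosedEmbedding_val.isEmbedding.isInducing.isOpen_iff.1 hU
  -- The cone over an open set is a neighbourhood of the midpoint of each of its generators, because
  -- the radial projection to the hyperboloid is continuous there.
  refine Measure.measure_pos_of_mem_nhds volume (x := (1 / 2 : ℝ) • x.1) ?_
  have hl : Continuous fun y : Fin (n + 1) → ℝ => lorentz y y :=
    continuous_lorentz.comp (continuous_id.prodMk continuous_id)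
  have hc0 : Continuous fun y : Fin (n + 1) → ℝ => y 0 := continuous_apply 0
  have hl0 : lorentz ((1 / 2 : ℝ) • x.1) ((1 / 2 : ℝ) • x.1) = -(1 / 4) := by
    rw [lorentz_smul_left, lorentz_smul_right, x.2.1]
    norm_num
  have hsq : √(1 / 4 : ℝ) = 1 / 2 := by
    rw [show (1 / 4 : ℝ) = (1 / 2) ^ 2 by norm_num]
    exact Real.sqrt_sq (by norm_num)
  have hi : ContinuousAt (fun y : Fin (n + 1) → ℝ => (√(-lorentz y y))⁻¹)
      ((1 / 2 : ℝ) • x.1) := by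
    refine ContinuousAt.inv₀ (Real.continuous_sqrt.comp hl.neg).continuousAt ?_
    rw [hl0, neg_neg, hsq]
    norm_num
  have hψ : ContinuousAt (fun y : Fin (n + 1) → ℝ => (√(-lorentz y y))⁻¹ • y)
      ((1 / 2 : ℝ) • x.1) := hi.smul continuousAt_id
  have hmem : (√(-lorentz ((1 / 2 : ℝ) • x.1) ((1 / 2 : ℝ) • x.1)))⁻¹ • (1 / 2 : ℝ) • x.1 ∈ U' := by
    rw [hl0, neg_neg, hsq, inv_smul_smul₀ (by norm_num)]
    exact hx
  filter_upwards [hψ.eventually (hU'.mem_nhds hmem),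
    hl.continuousAt.eventually (Ioo_mem_nhds (a := -1) (b := 0)
      (show -1 < lorentz ((1 / 2 : ℝ) • x.1) ((1 / 2 : ℝ) • x.1) by rw [hl0]; norm_num)
      (show lorentz ((1 / 2 : ℝ) • x.1) ((1 / 2 : ℝ) • x.1) < 0 by rw [hl0]; norm_num)),
    hc0.continuousAt.eventually (lt_mem_nhds (a := (0 : ℝ))
      (show (0 : ℝ) < ((1 / 2 : ℝ) • x.1) 0 by simpa using x.2.2))] with y hy1 hy2 hy3
  have hs : 0 < √(-lorentz y y) := Real.sqrt_pos.2 (by linarith)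
  have hss : √(-lorentz y y) ^ 2 = -lorentz y y := Real.sq_sqrt (by linarith)
  refine ⟨⟨(√(-lorentz y y))⁻¹ • y, ?_, ?_⟩, hy1, √(-lorentz y y), ⟨hs, ?_⟩, ?_⟩
  · rw [lorentz_smul_left, lorentz_smul_right]
    field_simp
    linarith
  · simpa using mul_pos (inv_pos.2 hs) hy3
  · rw [Real.sqrt_lt' one_pos]
    linarith
  · rw [smul_inv_smul₀ hs.ne']

end Hyp

end Volume

/-! ### The action on packings and joint measurability. -/

instance : ContinuousConstSMul (IsomPlus n) (NonemptyCompacts (Hyp n)) :=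
  ⟨fun g => (continuous_isomPlus_smul g).nonemptyCompacts_map⟩

theorem smul_mem_smul_compacts {g : IsomPlus n} {K : NonemptyCompacts (Hyp n)} {x : Hyp n} :
    g • x ∈ g • K ↔ x ∈ K :=
  (MulAction.injective g).mem_set_image (s := (K : Set (Hyp n)))

namespace Packing

theorem bodies_smul (g : IsomPlus n) (P : Packing n) :
    (g • P).bodies = (fun K => g • K) '' P.bodies := rfl

instance : ContinuousConstSMul (IsomPlus n) (Packing n) := by
  refine ⟨fun g => continuous_generateFrom_iff.2 ?_⟩
  rintro _ (⟨U, hU, rfl⟩ | ⟨C, hC, rfl⟩)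
  · refine isOpen_generateFrom_of_mem (Or.inl
      ⟨(fun K => g • K) ⁻¹' U, hU.preimage (continuous_const_smul g), ?_⟩)
    ext P
    simp only [mem_preimage, mem_ofPred_eq, bodies_smul, image_inter_nonempty_iff]
  · refine isOpen_generateFrom_of_mem (Or.inr
      ⟨(fun K => g • K) ⁻¹' C, (Homeomorph.smul g).isCompact_preimage.2 hC, ?_⟩)
    ext P
    simp only [mem_preimage, mem_ofPred_eq, bodies_smul, ← not_nonempty_iff_eq_empty,
      image_inter_nonempty_iff]

instance : MeasurableConstSMul (IsomPlus n) (Packing n) :=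
  ⟨fun g => (continuous_const_smul g).measurable⟩

instance {S : SubMulAction (IsomPlus n) (Packing n)} : MeasurableConstSMul (IsomPlus n) S :=
  ⟨fun g => (measurable_subtype_coe.const_smul g).subtype_mk⟩

instance : MeasurableConstSMul (IsomPlus n) (Hyp n) :=
  ⟨fun g => (continuous_const_smul g).measurable⟩

/-- Two points lie in a common body of the packing. -/
def SameBody (P : Packing n) (x y : Hyp n) : Prop := ∃ K ∈ P.bodies, x ∈ K ∧ y ∈ K

/-- A point lies in at least two bodies of the packing. -/
def IsMultiple (P : Packing n) (x : Hyp n) : Prop :=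
  ∃ K ∈ P.bodies, ∃ L ∈ P.bodies, K ≠ L ∧ x ∈ K ∧ x ∈ L

theorem mem_covered {P : Packing n} {x : Hyp n} : x ∈ P.covered ↔ ∃ K ∈ P.bodies, x ∈ K := by
  simp [covered]

theorem smul_mem_covered_smul {P : Packing n} {g : IsomPlus n} {x : Hyp n} :
    g • x ∈ (g • P).covered ↔ x ∈ P.covered := by
  simp only [mem_covered, bodies_smul, exists_mem_image, smul_mem_smul_compacts]

theorem sameBody_smul {P : Packing n} {g : IsomPlus n} {x y : Hyp n} :
    (g • P).SameBody (g • x) (g • y) ↔ P.SameBody x y := by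
  simp only [SameBody, bodies_smul, exists_mem_image, smul_mem_smul_compacts]

theorem sameBody_comm {P : Packing n} {x y : Hyp n} : P.SameBody x y ↔ P.SameBody y x := by
  simp only [SameBody, and_comm]

theorem isMultiple_smul {P : Packing n} {g : IsomPlus n} {x : Hyp n} :
    (g • P).IsMultiple (g • x) ↔ P.IsMultiple x := by
  simp only [IsMultiple, bodies_smul, exists_mem_image, smul_mem_smul_compacts, ne_eq,
    (MulAction.injective g).eq_iff]

theorem interior_nonempty {P : Packing n} {K : NonemptyCompacts (Hyp n)} (hK : K ∈ P.bodies) :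
    (interior (K : Set (Hyp n))).Nonempty := by
  rw [← closure_nonempty_iff, (P.isBody K hK).2]
  exact K.nonempty

/-- This makes a basic open set an unambiguous label for a body, and so reduces quantifiers over
bodies to countable unions. -/
theorem eq_of_subset {P : Packing n} {K L : NonemptyCompacts (Hyp n)} (hK : K ∈ P.bodies)
    (hL : L ∈ P.bodies) {b : Set (Hyp n)} (hb : IsOpen b) (hb' : b.Nonempty)
    (hbK : b ⊆ K) (hbL : b ⊆ L) : K = L := by
  by_contra hne
  obtain ⟨x, hx⟩ := hb'
  exact disjoint_left.1 (P.disjoint hK hL hne) (hb.subset_interior_iff.2 hbK hx)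
    (hb.subset_interior_iff.2 hbL hx)

theorem exists_basis_subset {P : Packing n} {K : NonemptyCompacts (Hyp n)} (hK : K ∈ P.bodies) :
    ∃ b ∈ countableBasis (Hyp n), b ⊆ interior (K : Set (Hyp n)) := by
  obtain ⟨x, hx⟩ := interior_nonempty hK
  obtain ⟨b, hb, -, hbK⟩ := (isBasis_countableBasis (Hyp n)).exists_subset_of_mem_open hx
    isOpen_interior
  exact ⟨b, hb, hbK⟩

theorem countable_bodies (P : Packing n) : P.bodies.Countable :=
  PairwiseDisjoint.countable_of_isOpen (ι := NonemptyCompacts (Hyp n))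
    (s := fun K => interior (K : Set (Hyp n)))
    P.disjoint (fun _ _ => isOpen_interior) fun _ => interior_nonempty

theorem measurableSet_covered (P : Packing n) : MeasurableSet P.covered :=
  .biUnion P.countable_bodies fun K _ => K.isCompact.measurableSet

/-- The pairs of a packing and a point of a body of that packing containing `b`. -/
def bodyOver (b : Set (Hyp n)) : Set (Packing n × Hyp n) :=
  {q | ∃ K ∈ q.1.bodies, b ⊆ K ∧ q.2 ∈ K}

/-- The restriction to bodies inside the compact set `L` turns the complement into a miss condition
for a compact family of compact sets, which is open in the Fell topology. -/
theorem isClosed_bodyOver_subset {b L : Set (Hyp n)} (hb : IsOpen b) (hb' : b.Nonempty)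
    (hL : IsCompact L) :
    IsClosed {q : Packing n × Hyp n | ∃ K ∈ q.1.bodies, b ⊆ K ∧ (K : Set (Hyp n)) ⊆ L ∧ q.2 ∈ K} := by
  rw [← isOpen_compl_iff, isOpen_iff_mem_nhds]
  rintro ⟨P, x⟩ hq
  simp only [mem_compl_iff, mem_ofPred_eq, not_exists, not_and] at hq
  -- At most one body contains `b`, so a single neighbourhood of `x` has to be separated from a
  -- single compact set.
  obtain ⟨V, hV, hVK⟩ : ∃ V : Set (Hyp n), V ∈ 𝓝 x ∧ ∀ K ∈ P.bodies, b ⊆ K → (K : Set (Hyp n)) ⊆ L →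
      Disjoint (K : Set (Hyp n)) (closure V) := by
    by_cases h : ∃ K ∈ P.bodies, b ⊆ K ∧ (K : Set (Hyp n)) ⊆ L
    · obtain ⟨K, hK, hbK, hKL⟩ := h
      have hx : x ∈ (K : Set (Hyp n))ᶜ := hq K hK hbK hKL
      obtain ⟨V, hV, hVc, hVK⟩ := exists_mem_nhds_isClosed_subset
        (K.isCompact.isClosed.isOpen_compl.mem_nhds hx)
      refine ⟨V, hV, fun K' hK' hbK' _ => ?_⟩
      rw [eq_of_subset hK' hK hb hb' hbK' hbK, hVc.closure_eq]
      exact disjoint_left.2 fun z hz hz' => hVK hz' hz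
    · exact ⟨univ, univ_mem, fun K hK h1 h2 => (h ⟨K, hK, h1, h2⟩).elim⟩
  -- The compact subsets of `L` form a compact family; containing `b` and meeting `closure V` are
  -- closed conditions on it.
  set C : Set (NonemptyCompacts (Hyp n)) :=
    {K | (K : Set (Hyp n)) ⊆ L} ∩
      ((⋂ z ∈ b, {K | ((K : Set (Hyp n)) ∩ {z}).Nonempty}) ∩
        {K | ((K : Set (Hyp n)) ∩ closure V).Nonempty}) with hC
  have hCc : IsCompact C := by
    refine (NonemptyCompacts.isCompact_subsets_of_isCompact hL).inter_right (IsClosed.inter ?_ ?_)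
    · exact isClosed_biInter fun z _ =>
        NonemptyCompacts.isClosed_inter_nonempty_of_isClosed isClosed_singleton
    · exact NonemptyCompacts.isClosed_inter_nonempty_of_isClosed isClosed_closure
  have hmem : ∀ K : NonemptyCompacts (Hyp n), K ∈ C ↔ (K : Set (Hyp n)) ⊆ L ∧ b ⊆ K ∧
      ((K : Set (Hyp n)) ∩ closure V).Nonempty := by
    intro K
    simp [hC, subset_def]
  have hU : IsOpen {Q : Packing n | Q.bodies ∩ C = ∅} :=
    isOpen_generateFrom_of_mem (Or.inr ⟨C, hCc, rfl⟩)
  have hPU : P ∈ {Q : Packing n | Q.bodies ∩ C = ∅} := by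
    refine eq_empty_of_forall_notMem fun K hK => ?_
    obtain ⟨hKP, hKC⟩ := hK
    obtain ⟨h1, h2, h3⟩ := (hmem K).1 hKC
    exact h3.ne_empty (hVK K hKP h2 h1).inter_eq
  filter_upwards [prod_mem_nhds (hU.mem_nhds hPU) hV]
  rintro ⟨Q, y⟩ ⟨hQ, hy⟩ ⟨K, hK, hbK, hKL, hyK⟩
  exact eq_empty_iff_forall_notMem.1 hQ K
    ⟨hK, (hmem K).2 ⟨hKL, hbK, y, hyK, subset_closure hy⟩⟩

theorem measurableSet_bodyOver {b : Set (Hyp n)} (hb : IsOpen b) (hb' : b.Nonempty) :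
    MeasurableSet (bodyOver b) := by
  let E : CompactExhaustion (Hyp n) := default
  have h : bodyOver b = ⋃ j, {q : Packing n × Hyp n | ∃ K ∈ q.1.bodies, b ⊆ K ∧
      (K : Set (Hyp n)) ⊆ E j ∧ q.2 ∈ K} := by
    ext q
    simp only [bodyOver, mem_ofPred_eq, mem_iUnion]
    constructor
    · rintro ⟨K, hK, h1, h2⟩
      obtain ⟨j, hj⟩ := E.exists_superset_of_isCompact K.isCompact
      exact ⟨j, K, hK, h1, hj, h2⟩
    · rintro ⟨j, K, hK, h1, -, h2⟩
      exact ⟨K, hK, h1, h2⟩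
  rw [h]
  exact .iUnion fun j => (isClosed_bodyOver_subset hb hb' (E.isCompact j)).measurableSet

theorem measurableSet_mem_covered :
    MeasurableSet {q : Packing n × Hyp n | q.2 ∈ q.1.covered} := by
  have h : {q : Packing n × Hyp n | q.2 ∈ q.1.covered} =
      ⋃ b ∈ countableBasis (Hyp n), bodyOver b := by
    ext ⟨P, x⟩
    simp only [mem_ofPred_eq, mem_covered, mem_iUnion, bodyOver, exists_prop]
    constructor
    · rintro ⟨K, hK, hx⟩
      obtain ⟨b, hb, hbK⟩ := exists_basis_subset hK
      exact ⟨b, hb, K, hK, hbK.trans interior_subset, hx⟩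
    · rintro ⟨b, -, K, hK, -, hx⟩
      exact ⟨K, hK, hx⟩
  rw [h]
  exact .biUnion (countable_countableBasis _) fun b hb =>
    measurableSet_bodyOver (isOpen_of_mem_countableBasis hb) (nonempty_of_mem_countableBasis hb)

theorem measurableSet_sameBody :
    MeasurableSet {q : Packing n × Hyp n × Hyp n | q.1.SameBody q.2.1 q.2.2} := by
  have h : {q : Packing n × Hyp n × Hyp n | q.1.SameBody q.2.1 q.2.2} =
      ⋃ b ∈ countableBasis (Hyp n), (fun q => (q.1, q.2.1)) ⁻¹' bodyOver b ∩
        (fun q => (q.1, q.2.2)) ⁻¹' bodyOver b := by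
    ext ⟨P, x, y⟩
    simp only [mem_ofPred_eq, mem_iUnion, bodyOver, exists_prop, SameBody, mem_inter_iff,
      mem_preimage]
    constructor
    · rintro ⟨K, hK, hx, hy⟩
      obtain ⟨b, hb, hbK⟩ := exists_basis_subset hK
      have hbK := hbK.trans interior_subset
      exact ⟨b, hb, ⟨K, hK, hbK, hx⟩, ⟨K, hK, hbK, hy⟩⟩
    · rintro ⟨b, hb, ⟨K, hK, hbK, hx⟩, ⟨L, hL, hbL, hy⟩⟩
      obtain rfl := eq_of_subset hK hL (isOpen_of_mem_countableBasis hb)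
        (nonempty_of_mem_countableBasis hb) hbK hbL
      exact ⟨K, hK, hx, hy⟩
  rw [h]
  refine .biUnion (countable_countableBasis _) fun b hb => ?_
  have hm := measurableSet_bodyOver (isOpen_of_mem_countableBasis hb)
    (nonempty_of_mem_countableBasis hb)
  exact (hm.preimage (by fun_prop)).inter (hm.preimage (by fun_prop))

/-- Distinctness of the bodies over `b` and `c` is tested at one chosen point of `c`. That point is
interior to the second body, so the first, being the closure of an interior disjoint from it, misses
the point unless the two coincide. -/
theorem measurableSet_isMultiple :
    MeasurableSet {q : Packing n × Hyp n | q.1.IsMultiple q.2} := by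
  choose z hz using fun b : countableBasis (Hyp n) => nonempty_of_mem_countableBasis b.2
  have h : {q : Packing n × Hyp n | q.1.IsMultiple q.2} =
      ⋃ b : countableBasis (Hyp n), ⋃ c : countableBasis (Hyp n),
        bodyOver b.1 ∩ (bodyOver c.1 ∩ (fun q => (q.1, z c)) ⁻¹' (bodyOver b.1)ᶜ) := by
    ext ⟨P, x⟩
    simp only [mem_ofPred_eq, mem_iUnion, bodyOver, IsMultiple, mem_inter_iff, mem_preimage,
      mem_compl_iff]
    constructor
    · rintro ⟨K, hK, L, hL, hne, hx, hx'⟩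
      obtain ⟨b, hb, hbK⟩ := exists_basis_subset hK
      obtain ⟨c, hc, hcL⟩ := exists_basis_subset hL
      have hbK' := hbK.trans interior_subset
      refine ⟨⟨b, hb⟩, ⟨c, hc⟩, ⟨K, hK, hbK', hx⟩, ⟨L, hL, hcL.trans interior_subset, hx'⟩, ?_⟩
      rintro ⟨K', hK', hbK'', hzK⟩
      obtain rfl := eq_of_subset hK hK' (isOpen_of_mem_countableBasis hb)
        (nonempty_of_mem_countableBasis hb) hbK' hbK''
      have hzK' : z ⟨c, hc⟩ ∈ closure (interior (K : Set (Hyp n))) := by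
        rw [(P.isBody K hK).2]
        exact hzK
      exact disjoint_left.1 ((P.disjoint hK hL hne).closure_left isOpen_interior) hzK'
        (hcL (hz ⟨c, hc⟩))
    · rintro ⟨⟨b, hb⟩, ⟨c, hc⟩, ⟨K, hK, hbK, hx⟩, ⟨L, hL, hcL, hx'⟩, hno⟩
      refine ⟨K, hK, L, hL, ?_, hx, hx'⟩
      rintro rfl
      exact hno ⟨K, hK, hbK, hcL (hz ⟨c, hc⟩)⟩
  rw [h]
  have : Countable (countableBasis (Hyp n)) := (countable_countableBasis _).to_subtype
  have hm : ∀ b : countableBasis (Hyp n), MeasurableSet (bodyOver b.1) := fun b =>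
    measurableSet_bodyOver (isOpen_of_mem_countableBasis b.2) (nonempty_of_mem_countableBasis b.2)
  exact .iUnion fun b => .iUnion fun c =>
    (hm b).inter ((hm c).inter ((hm b).compl.preimage (by fun_prop)))

theorem vol_isMultiple {P : Packing n} (hP : P.bodies.Pairwise fun K L =>
    Hyp.vol ((K : Set (Hyp n)) ∩ (L : Set (Hyp n))) = 0) :
    Hyp.vol {x | P.IsMultiple x} = 0 := by
  have h : {x | P.IsMultiple x} ⊆
      ⋃ K ∈ P.bodies, ⋃ L ∈ P.bodies \ {K}, (K : Set (Hyp n)) ∩ (L : Set (Hyp n)) := by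
    rintro x ⟨K, hK, L, hL, hne, hx, hx'⟩
    exact mem_biUnion hK (mem_biUnion (⟨hL, hne.symm⟩ : L ∈ P.bodies \ {K}) ⟨hx, hx'⟩)
  refine measure_mono_null h ((measure_biUnion_null_iff P.countable_bodies).2 fun K hK =>
    (measure_biUnion_null_iff (P.countable_bodies.mono sdiff_subset)).2 fun L hL => ?_)
  exact hP hK hL.1 fun h => hL.2 h.symm

end Packing

variable {S : SubMulAction (IsomPlus n) (Packing n)}

theorem Hyp.vol_body_ne_zero {P : Packing n} {K : NonemptyCompacts (Hyp n)} (hK : K ∈ P.bodies) :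
    Hyp.vol (K : Set (Hyp n)) ≠ 0 :=
  (Measure.measure_pos_of_nonempty_interior _ (Packing.interior_nonempty hK)).ne'

theorem Hyp.vol_compact_ne_top (K : NonemptyCompacts (Hyp n)) :
    Hyp.vol (K : Set (Hyp n)) ≠ ∞ :=
  K.isCompact.measure_lt_top.ne

theorem measurableSet_covered_prod :
    MeasurableSet {q : S × Hyp n | q.2 ∈ (q.1 : Packing n).covered} :=
  Packing.measurableSet_mem_covered.preimage
    ((measurable_subtype_coe.comp measurable_fst).prodMk measurable_snd)

theorem measurableSet_setOf_mem_covered (p : Hyp n) :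
    MeasurableSet {P : S | p ∈ (P : Packing n).covered} :=
  measurableSet_covered_prod.preimage measurable_prodMk_right

theorem lintegral_comp_smul {G α : Type*} [Group G] [MulAction G α] [MeasurableSpace α]
    [MeasurableConstSMul G α] (ν : Measure α) [SMulInvariantMeasure G α ν] (g : G)
    (f : α → ℝ≥0∞) : ∫⁻ x, f (g • x) ∂ν = ∫⁻ x, f x ∂ν :=
  (measurePreserving_smul g ν).lintegral_comp_emb (measurableEmbedding_const_smul g) f

/-! ### The transport kernel and the mass it sends and delivers. -/

namespace Packing

/-- The indicator function of the bodies of the packing containing `x`. -/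
def sameBodyIndicator (T : Packing n) (x y : Hyp n) : ℝ≥0∞ :=
  {y | T.SameBody x y}.indicator 1 y

/-- The volume of the union of the bodies containing `x`. -/
def cellVol (T : Packing n) (x : Hyp n) : ℝ≥0∞ :=
  ∫⁻ z, T.sameBodyIndicator x z ∂Hyp.vol

/-- Each point covered by `P` spreads a unit mass uniformly over its tile in `T`. -/
def transport (P T : Packing n) (x y : Hyp n) : ℝ≥0∞ :=
  P.covered.indicator 1 x * T.sameBodyIndicator x y * (T.cellVol x)⁻¹

theorem measurable_sameBodyIndicator :
    Measurable fun q : Packing n × Hyp n × Hyp n => q.1.sameBodyIndicator q.2.1 q.2.2 :=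
  measurable_one.indicator measurableSet_sameBody

theorem measurable_cellVol : Measurable fun q : Packing n × Hyp n => q.1.cellVol q.2 :=
  Measurable.lintegral_prod_right'
    (f := fun q : (Packing n × Hyp n) × Hyp n => q.1.1.sameBodyIndicator q.1.2 q.2)
    (measurable_sameBodyIndicator.comp MeasurableEquiv.prodAssoc.measurable)

theorem measurable_coverIndicator :
    Measurable fun q : Packing n × Hyp n => q.1.covered.indicator (1 : Hyp n → ℝ≥0∞) q.2 :=
  measurable_one.indicator measurableSet_mem_covered

theorem sameBodyIndicator_smul (g : IsomPlus n) (T : Packing n) (x y : Hyp n) :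
    (g • T).sameBodyIndicator (g • x) (g • y) = T.sameBodyIndicator x y :=
  indicator_eq_indicator sameBody_smul rfl

theorem cellVol_smul (g : IsomPlus n) (T : Packing n) (x : Hyp n) :
    (g • T).cellVol (g • x) = T.cellVol x := by
  rw [cellVol, ← lintegral_comp_smul Hyp.vol g]
  simp only [sameBodyIndicator_smul, cellVol]

theorem transport_smul (g : IsomPlus n) (P T : Packing n) (x y : Hyp n) :
    transport (g • P) (g • T) (g • x) (g • y) = transport P T x y := by
  rw [transport, transport, cellVol_smul, sameBodyIndicator_smul]
  congr 2
  exact indicator_eq_indicator smul_mem_covered_smul rfl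

theorem sameBodyIndicator_eq {T : Packing n} {K : NonemptyCompacts (Hyp n)} (hK : K ∈ T.bodies)
    {x : Hyp n} (hx : x ∈ K) (hmul : ¬ T.IsMultiple x) (y : Hyp n) :
    T.sameBodyIndicator x y = (K : Set (Hyp n)).indicator 1 y := by
  refine indicator_eq_indicator ⟨?_, fun hy => ⟨K, hK, hx, hy⟩⟩ rfl
  rintro ⟨L, hL, hxL, hyL⟩
  by_contra hy
  exact hmul ⟨L, hL, K, hK, fun h => hy (h ▸ hyL), hxL, hx⟩

theorem cellVol_eq {T : Packing n} {K : NonemptyCompacts (Hyp n)} (hK : K ∈ T.bodies)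
    {x : Hyp n} (hx : x ∈ K) (hmul : ¬ T.IsMultiple x) :
    T.cellVol x = Hyp.vol (K : Set (Hyp n)) := by
  simp only [cellVol, sameBodyIndicator_eq hK hx hmul]
  exact lintegral_indicator_one K.isCompact.measurableSet

theorem lintegral_transport_out (P : Packing n) {T : Packing n} {K : NonemptyCompacts (Hyp n)}
    (hK : K ∈ T.bodies) {x : Hyp n} (hx : x ∈ K) (hmul : ¬ T.IsMultiple x) :
    ∫⁻ y, transport P T x y ∂Hyp.vol = P.covered.indicator 1 x := by
  have hm := (measurable_one (β := Hyp n) (α := ℝ≥0∞)).indicator K.isCompact.measurableSet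
  simp only [transport, cellVol_eq hK hx hmul, sameBodyIndicator_eq hK hx hmul]
  rw [lintegral_mul_const _ (hm.const_mul _), lintegral_const_mul _ hm,
    lintegral_indicator_one K.isCompact.measurableSet, mul_assoc,
    ENNReal.mul_inv_cancel (Hyp.vol_body_ne_zero hK) (Hyp.vol_compact_ne_top K), mul_one]

theorem lintegral_transport_in (P : Packing n) {T : Packing n} {K : NonemptyCompacts (Hyp n)}
    (hK : K ∈ T.bodies) {x : Hyp n} (hx : x ∈ K) (hmul : ¬ T.IsMultiple x)
    (hT : Hyp.vol {y | T.IsMultiple y} = 0) :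
    ∫⁻ y, transport P T y x ∂Hyp.vol =
      Hyp.vol (P.covered ∩ (K : Set (Hyp n))) / Hyp.vol (K : Set (Hyp n)) := by
  have hae : ∀ᵐ y ∂Hyp.vol, transport P T y x =
      (P.covered ∩ (K : Set (Hyp n))).indicator 1 y * (Hyp.vol (K : Set (Hyp n)))⁻¹ := by
    have h0 : ∀ᵐ y ∂Hyp.vol, ¬ T.IsMultiple y := by
      rw [ae_iff]
      simpa using hT
    filter_upwards [h0] with y hy
    -- The point `x` lies in `K` only, so precisely the points of `K` reach it; almost all of these
    -- have no other tile and see the same volume.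
    have hs : T.sameBodyIndicator y x = (K : Set (Hyp n)).indicator 1 y := by
      rw [← sameBodyIndicator_eq hK hx hmul y]
      exact indicator_eq_indicator sameBody_comm rfl
    by_cases hyK : y ∈ (K : Set (Hyp n))
    · rw [transport, cellVol_eq hK hyK hy, hs, inter_indicator_one, Pi.mul_apply]
    · rw [transport, hs, inter_indicator_one, Pi.mul_apply, indicator_of_notMem hyK, mul_zero,
        zero_mul, zero_mul]
  have hm : MeasurableSet (P.covered ∩ (K : Set (Hyp n))) :=
    P.measurableSet_covered.inter K.isCompact.measurableSet
  rw [lintegral_congr_ae hae, lintegral_mul_const _ (measurable_one.indicator hm),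
    lintegral_indicator_one hm, div_eq_mul_inv]

theorem measurable_transport {φ : S → Packing n} (hφ : Measurable φ) :
    Measurable fun q : S × Hyp n × Hyp n => transport (q.1 : Packing n) (φ q.1) q.2.1 q.2.2 := by
  have h1 : Measurable fun q : S × Hyp n × Hyp n => ((q.1 : Packing n), q.2.1) :=
    (measurable_subtype_coe.comp measurable_fst).prodMk (measurable_fst.comp measurable_snd)
  have h2 : Measurable fun q : S × Hyp n × Hyp n => (φ q.1, q.2.1) :=
    (hφ.comp measurable_fst).prodMk (measurable_fst.comp measurable_snd)
  have h3 : Measurable fun q : S × Hyp n × Hyp n => (φ q.1, q.2) :=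
    (hφ.comp measurable_fst).prodMk measurable_snd
  exact ((measurable_coverIndicator.comp h1).mul (measurable_sameBodyIndicator.comp h3)).mul
    (measurable_cellVol.comp h2).inv

end Packing

/-! ### Mass transport and the tile formula. -/

section Invariant

variable (μ : Measure S) [SMulInvariantMeasure (IsomPlus n) S μ]

theorem measure_eq_of_equivariant (hn : 2 ≤ n) {A : Set (S × Hyp n)}
    (hinv : ∀ (g : IsomPlus n) (P : S) (x : Hyp n), (g • P, g • x) ∈ A ↔ (P, x) ∈ A)
    (p q : Hyp n) : μ {P | (P, p) ∈ A} = μ {P | (P, q) ∈ A} := by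
  obtain ⟨g, rfl, -⟩ := exists_swap hn q p
  have h : {P | (P, g • q) ∈ A} = (fun P => g⁻¹ • P) ⁻¹' {P | (P, q) ∈ A} := by
    ext P
    rw [mem_preimage, mem_ofPred_eq, mem_ofPred_eq, ← hinv g (g⁻¹ • P), smul_inv_smul]
  rw [h]
  exact measure_preimage_smul μ g⁻¹ _

theorem averageDensity_eq_measure (hn : 2 ≤ n) (p : Hyp n) :
    averageDensity μ = μ.real {P : S | p ∈ (P : Packing n).covered} := by
  have h : averageDensity μ = μ.real {P : S | Hyp.origin ∈ (P : Packing n).covered} :=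
    integral_indicator_one (μ := μ) (measurableSet_setOf_mem_covered (S := S) Hyp.origin)
  rw [h, measureReal_def, measureReal_def]
  congr 1
  exact measure_eq_of_equivariant μ hn
    (A := {q : S × Hyp n | q.2 ∈ (q.1 : Packing n).covered})
    (fun g P x => Packing.smul_mem_covered_smul) Hyp.origin p

/-- The mass transport principle. -/
theorem mass_transport [SFinite μ] (hn : 2 ≤ n) {m : S → Hyp n → Hyp n → ℝ≥0∞}
    (hm : Measurable fun q : S × Hyp n × Hyp n => m q.1 q.2.1 q.2.2)
    (hinv : ∀ (g : IsomPlus n) (P : S) (x y : Hyp n), m (g • P) (g • x) (g • y) = m P x y)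
    (p : Hyp n) :
    ∫⁻ P, ∫⁻ y, m P p y ∂Hyp.vol ∂μ = ∫⁻ P, ∫⁻ y, m P y p ∂Hyp.vol ∂μ := by
  have h1 : Measurable fun q : S × Hyp n => m q.1 p q.2 :=
    hm.comp (measurable_fst.prodMk (measurable_const.prodMk measurable_snd))
  have h2 : Measurable fun q : S × Hyp n => m q.1 q.2 p :=
    hm.comp (measurable_fst.prodMk (measurable_snd.prodMk measurable_const))
  rw [lintegral_lintegral_swap (f := fun P y => m P p y) h1.aemeasurable,
    lintegral_lintegral_swap (f := fun P y => m P y p) h2.aemeasurable]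
  refine lintegral_congr fun y => ?_
  -- With `y` fixed after Tonelli, an isometry exchanging `p` and `y` turns mass sent into mass
  -- received, and `μ` does not notice the change of packing.
  obtain ⟨g, hgp, hgy⟩ := exists_swap hn p y
  rw [← lintegral_comp_smul μ g fun P => m P y p]
  refine lintegral_congr fun P => ?_
  have h := hinv g P p y
  rw [hgp, hgy] at h
  exact h.symm

variable {μ}

/-- The exceptional set is null for `μ.prod vol`, and by equivariance all its slices at points have
the same `μ`-measure. As the space has positive volume, that common measure is zero. -/
theorem ae_not_isMultiple [SFinite μ] (hn : 2 ≤ n) {φ : S → Packing n} (hφ : Measurable φ)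
    (hequiv : ∀ (g : IsomPlus n) (P : S), φ (g • P) = g • φ P)
    (hnull : ∀ᵐ P ∂μ, (φ P).bodies.Pairwise fun K L =>
      Hyp.vol ((K : Set (Hyp n)) ∩ (L : Set (Hyp n))) = 0) (p : Hyp n) :
    ∀ᵐ P ∂μ, ¬ (φ P).IsMultiple p := by
  set A : Set (S × Hyp n) := {q | (φ q.1).IsMultiple q.2} with hA
  have hAm : MeasurableSet A := Packing.measurableSet_isMultiple.preimage
    ((hφ.comp measurable_fst).prodMk measurable_snd)
  have h0 : (μ.prod Hyp.vol) A = 0 := by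
    rw [Measure.measure_prod_null hAm]
    filter_upwards [hnull] with P hP using Packing.vol_isMultiple hP
  have hconst : ∀ x, μ {P | (P, x) ∈ A} = μ {P | (P, p) ∈ A} := fun x =>
    measure_eq_of_equivariant μ hn (fun g P x => by
      simp only [hA, mem_ofPred_eq, hequiv, Packing.isMultiple_smul]) x p
  rw [Measure.prod_apply_symm hAm] at h0
  have h1 : ∫⁻ _ : Hyp n, μ {P | (P, p) ∈ A} ∂Hyp.vol = 0 := by
    rw [← h0]
    exact lintegral_congr fun x => (hconst x).symm
  rw [lintegral_const, mul_eq_zero] at h1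
  have h2 := h1.resolve_right (isOpen_univ.measure_pos _ univ_nonempty).ne'
  rw [ae_iff]
  simpa [hA] using h2

/-- The average density is the mean density of the packing in the tile at `p` of an equivariantly
associated tiling. -/
theorem averageDensity_eq_integral_tile [IsProbabilityMeasure μ] (hn : 2 ≤ n) {φ : S → Packing n}
    (hφ : Measurable φ) (hequiv : ∀ (g : IsomPlus n) (P : S), φ (g • P) = g • φ P)
    (hnull : ∀ᵐ P ∂μ, (φ P).bodies.Pairwise fun K L =>
      Hyp.vol ((K : Set (Hyp n)) ∩ (L : Set (Hyp n))) = 0)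
    (p : Hyp n) (τ : S → NonemptyCompacts (Hyp n))
    (hτ : ∀ P : S, τ P ∈ (φ P).bodies ∧ p ∈ τ P) :
    Integrable (fun P : S => Hyp.vol.real ((P : Packing n).covered ∩ (τ P : Set _)) /
      Hyp.vol.real (τ P : Set (Hyp n))) μ ∧
    averageDensity μ = ∫ P : S, Hyp.vol.real ((P : Packing n).covered ∩ (τ P : Set _)) /
      Hyp.vol.real (τ P : Set (Hyp n)) ∂μ := by
  have hgood := ae_not_isMultiple hn hφ hequiv hnull p
  obtain ⟨m, hm⟩ : ∃ m : S → Hyp n → Hyp n → ℝ≥0∞, ∀ P x y,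
      m P x y = Packing.transport P (φ P) x y := ⟨_, fun _ _ _ => rfl⟩
  have hmt : Measurable fun q : S × Hyp n × Hyp n => m q.1 q.2.1 q.2.2 := by
    simp only [hm]
    exact Packing.measurable_transport hφ
  have hinv : ∀ (g : IsomPlus n) (P : S) (x y : Hyp n), m (g • P) (g • x) (g • y) = m P x y := by
    intro g P x y
    rw [hm, hm, hequiv]
    exact Packing.transport_smul g P (φ P) x y
  have hmm : Measurable fun P => ∫⁻ y, m P y p ∂Hyp.vol := by
    have h : Measurable fun q : S × Hyp n => m q.1 q.2 p :=
      hmt.comp (measurable_fst.prodMk (measurable_snd.prodMk measurable_const))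
    exact h.lintegral_prod_right'
  -- The choice `τ` carries no measurability; the integrand is measurable only up to a null set,
  -- through this identity with the mass received.
  have hin : (fun P : S => Hyp.vol.real ((P : Packing n).covered ∩ (τ P : Set (Hyp n))) /
      Hyp.vol.real (τ P : Set (Hyp n))) =ᵐ[μ] fun P => (∫⁻ y, m P y p ∂Hyp.vol).toReal := by
    filter_upwards [hgood, hnull] with P hP hPn
    simp only [hm]
    rw [Packing.lintegral_transport_in P (hτ P).1 (hτ P).2 hP (Packing.vol_isMultiple hPn),
      ENNReal.toReal_div, measureReal_def, measureReal_def]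
  have hout : ∀ᵐ P : S ∂μ, ∫⁻ y, m P p y ∂Hyp.vol =
      {P : S | p ∈ (P : Packing n).covered}.indicator 1 P := by
    filter_upwards [hgood] with P hP
    simp only [hm]
    rw [Packing.lintegral_transport_out P (hτ P).1 (hτ P).2 hP]
    exact indicator_eq_indicator Iff.rfl rfl
  have htotal : ∫⁻ P, ∫⁻ y, m P y p ∂Hyp.vol ∂μ =
      μ {P : S | p ∈ (P : Packing n).covered} := by
    rw [← mass_transport μ hn hmt hinv p, lintegral_congr_ae hout]
    exact lintegral_indicator_one (measurableSet_setOf_mem_covered p)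
  have hfin : ∫⁻ P, ∫⁻ y, m P y p ∂Hyp.vol ∂μ ≠ ∞ := by
    rw [htotal]
    exact measure_ne_top _ _
  refine ⟨(integrable_congr hin).2 (integrable_toReal_of_lintegral_ne_top hmm.aemeasurable hfin), ?_⟩
  rw [integral_congr_ae hin, integral_toReal hmm.aemeasurable (ae_lt_top hmm hfin), htotal,
    averageDensity_eq_measure μ hn p, measureReal_def]

end Invariant

end HypPacking

/-! ### Fundamental domains of invariant measures. -/

/-- Mass transport over a fundamental domain. -/
theorem MeasureTheory.IsFundamentalDomain.setLIntegral_lintegral_comm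
    {G α : Type*} [Group G] [Countable G] [MulAction G α] [MeasurableSpace α]
    [MeasurableConstSMul G α] {ν : Measure α} [SFinite ν] [SMulInvariantMeasure G α ν]
    {F : Set α} (hF : IsFundamentalDomain G F ν) {K : α → α → ℝ≥0∞}
    (hK : Measurable (Function.uncurry K)) (hinv : ∀ (g : G) x y, K (g • x) (g • y) = K x y) :
    ∫⁻ x in F, ∫⁻ y, K x y ∂ν ∂ν = ∫⁻ x in F, ∫⁻ y, K y x ∂ν ∂ν := by
  have h1 : ∀ g : G, Measurable fun q : α × α => K q.1 (g⁻¹ • q.2) := fun g =>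
    hK.comp (measurable_fst.prodMk (measurable_snd.const_smul g⁻¹))
  have h2 : ∀ g : G, Measurable fun q : α × α => K (g • q.2) q.1 := fun g =>
    hK.comp ((measurable_snd.const_smul g).prodMk measurable_fst)
  -- Unfold the inner integral over the translates of `F`, move the group element to the other
  -- variable by invariance, and fold back.
  calc ∫⁻ x in F, ∫⁻ y, K x y ∂ν ∂ν
      = ∫⁻ x in F, ∑' g : G, ∫⁻ y in F, K x (g⁻¹ • y) ∂ν ∂ν :=
        lintegral_congr fun x => hF.lintegral_eq_tsum' _
    _ = ∑' g : G, ∫⁻ x in F, ∫⁻ y in F, K x (g⁻¹ • y) ∂ν ∂ν :=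
        lintegral_tsum fun g => (h1 g).lintegral_prod_right'.aemeasurable
    _ = ∑' g : G, ∫⁻ y in F, ∫⁻ x in F, K x (g⁻¹ • y) ∂ν ∂ν :=
        tsum_congr fun g => lintegral_lintegral_swap (f := fun x y => K x (g⁻¹ • y))
          (h1 g).aemeasurable
    _ = ∑' g : G, ∫⁻ y in F, ∫⁻ x in F, K (g • x) y ∂ν ∂ν := by
        refine tsum_congr fun g => lintegral_congr fun y => lintegral_congr fun x => ?_
        rw [← hinv g, smul_inv_smul]
    _ = ∫⁻ y in F, ∑' g : G, ∫⁻ x in F, K (g • x) y ∂ν ∂ν :=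
        (lintegral_tsum fun g => (h2 g).lintegral_prod_right'.aemeasurable).symm
    _ = ∫⁻ x in F, ∫⁻ y, K y x ∂ν ∂ν :=
        lintegral_congr fun x => (hF.lintegral_eq_tsum'' fun y => K y x).symm

/-- The translates of `F` are almost disjoint and of equal positive measure, and an s-finite measure
has room for only countably many of them. -/
theorem MeasureTheory.IsFundamentalDomain.countable_of_measure_ne_zero
    {G α : Type*} [Group G] [MulAction G α] [MeasurableSpace α]
    [MeasurableConstSMul G α] {ν : Measure α} [SFinite ν] [SMulInvariantMeasure G α ν]
    {F : Set α} (hF : IsFundamentalDomain G F ν) (h0 : ν F ≠ 0) : Countable G := by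
  have h := Measure.countable_meas_pos_of_disjoint_iUnion₀
    (fun g : G => hF.nullMeasurableSet_smul g) hF.aedisjoint
  simp only [measure_smul, pos_iff_ne_zero, ne_eq, h0, not_false_eq_true] at h
  exact countable_univ_iff.1 (by simpa using h)

/-- The measure of `C` is the sum of those of the pieces of `F` in the translates of `C`, and these
cover `F`. It yields finite volume of `F` in the cocompact case. -/
theorem MeasureTheory.IsFundamentalDomain.measure_le_of_forall_exists_smul_mem
    {G α : Type*} [Group G] [Countable G] [MulAction G α] [MeasurableSpace α]
    [MeasurableConstSMul G α] {ν : Measure α} [SMulInvariantMeasure G α ν]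
    {F C : Set α} (hF : IsFundamentalDomain G F ν) (hC : ∀ x, ∃ g : G, g • x ∈ C) :
    ν F ≤ ν C := by
  rw [hF.measure_eq_tsum C]
  refine le_trans (measure_mono fun x hx => ?_) (measure_iUnion_le _)
  obtain ⟨g, hg⟩ := hC x
  exact mem_iUnion.2 ⟨g⁻¹, mem_smul_set_iff_inv_smul_mem.2 (by simpa using hg), hx⟩

/-! ### Hyperbolic balls and iterated ball averages. -/

namespace HypPacking

variable {n : ℕ}

namespace Hyp

/-- The ball of all points `y` with `cosh d(x, y) < c`. -/
def coshBall (c : ℝ) (x : Hyp n) : Set (Hyp n) := {y | -lorentz x.1 y.1 < c}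

theorem mem_coshBall {c : ℝ} {x y : Hyp n} : y ∈ coshBall c x ↔ -lorentz x.1 y.1 < c := Iff.rfl

theorem mem_coshBall_comm {c : ℝ} {x y : Hyp n} : y ∈ coshBall c x ↔ x ∈ coshBall c y := by
  rw [mem_coshBall, mem_coshBall, lorentz_comm]

theorem smul_mem_coshBall_smul {c : ℝ} {g : IsomPlus n} {x y : Hyp n} :
    g • y ∈ coshBall c (g • x) ↔ y ∈ coshBall c x := by
  rw [mem_coshBall, mem_coshBall, lorentz_smul_smul]

theorem continuous_lorentz_val :
    Continuous fun q : Hyp n × Hyp n => lorentz q.1.1 q.2.1 :=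
  continuous_lorentz.comp ((continuous_val.comp continuous_fst).prodMk
    (continuous_val.comp continuous_snd))

theorem isOpen_coshBall_prod (c : ℝ) :
    IsOpen {q : Hyp n × Hyp n | q.2 ∈ coshBall c q.1} :=
  isOpen_lt continuous_lorentz_val.neg continuous_const

theorem isOpen_coshBall (c : ℝ) (x : Hyp n) : IsOpen (coshBall c x) :=
  (isOpen_coshBall_prod c).preimage (Continuous.prodMk_right x)

theorem isCompact_coshClosedBall (c : ℝ) :
    IsCompact {y : Hyp n | -lorentz (origin : Hyp n).1 y.1 ≤ c} := by
  have hsub : {y : Hyp n | -lorentz (origin : Hyp n).1 y.1 ≤ c} ⊆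
      (fun y : Hyp n => y.1) ⁻¹' Metric.closedBall 0 c := by
    intro y hy
    -- The distance to the origin bounds the time coordinate, which on the hyperboloid dominates all
    -- the others.
    have h0 : y.1 0 ≤ c := by
      simpa [lorentz, origin, Fin.succ_ne_zero] using hy
    have hy0 := y.2.2
    have hy1 := y.2.1
    rw [mem_preimage, mem_closedBall_zero_iff, pi_norm_le_iff_of_nonneg (hy0.le.trans h0)]
    refine Fin.cases ?_ fun i => ?_
    · rw [Real.norm_eq_abs, abs_of_pos hy0]
      exact h0
    · refine le_trans (abs_le_of_sq_le_sq ?_ hy0.le) h0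
      have hi := Finset.single_le_sum (f := fun i : Fin n => y.1 i.succ * y.1 i.succ)
        (fun i _ => mul_self_nonneg _) (Finset.mem_univ i)
      simp only [lorentz] at hy1
      nlinarith
  refine (isClosedEmbedding_val.isCompact_preimage (isCompact_closedBall 0 c)).of_isClosed_subset
    ?_ hsub
  exact isClosed_le (continuous_lorentz_val.comp (Continuous.prodMk_right origin)).neg
    continuous_const

theorem vol_coshBall (hn : 2 ≤ n) (c : ℝ) (x : Hyp n) :
    vol (coshBall c x) = vol (coshBall c (origin : Hyp n)) := by
  obtain ⟨g, rfl, -⟩ := exists_swap hn origin x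
  rw [← measure_preimage_smul vol g (coshBall c (g • origin))]
  congr 1
  ext y
  exact smul_mem_coshBall_smul

theorem vol_coshBall_ne_top (hn : 2 ≤ n) (c : ℝ) (x : Hyp n) : vol (coshBall c x) ≠ ∞ := by
  rw [vol_coshBall hn]
  exact ((measure_mono fun y (hy : _ < c) => hy.le).trans_lt
    (isCompact_coshClosedBall c).measure_lt_top).ne

/-- The mean of `f` over the balls of radius `arcosh c`. -/
def ballAverage (c : ℝ) (f : Hyp n → ℝ) (x : Hyp n) : ℝ :=
  (vol.real (coshBall c (origin : Hyp n)))⁻¹ * ∫ y in coshBall c x, f y ∂vol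

theorem ballAverage_comp_smul (c : ℝ) (f : Hyp n → ℝ) (g : IsomPlus n) (x : Hyp n) :
    ballAverage c (fun y => f (g • y)) x = ballAverage c f (g • x) := by
  have h : coshBall c x = (fun y => g • y) ⁻¹' coshBall c (g • x) := by
    ext y
    exact smul_mem_coshBall_smul.symm
  rw [ballAverage, ballAverage, h, (measurePreserving_smul g vol).setIntegral_preimage_emb
    (measurableEmbedding_const_smul g)]

theorem ballAverage_iterate_comp_smul (c : ℝ) (f : Hyp n → ℝ) (g : IsomPlus n) (k : ℕ)
    (x : Hyp n) :
    (ballAverage c)^[k] (fun y => f (g • y)) x = (ballAverage c)^[k] f (g • x) := by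
  induction k generalizing x with
  | zero => rfl
  | succ k ih =>
    rw [Function.iterate_succ_apply', Function.iterate_succ_apply', ← ballAverage_comp_smul,
      funext ih]

theorem measurable_ballAverage {X : Type*} [MeasurableSpace X] (c : ℝ) {h : X → Hyp n → ℝ}
    (hh : Measurable (Function.uncurry h)) :
    Measurable (Function.uncurry fun P x => ballAverage c (h P) x) := by
  have hm : Measurable fun q : (X × Hyp n) × Hyp n =>
      {q : (X × Hyp n) × Hyp n | q.2 ∈ coshBall c q.1.2}.indicator
        (fun q => Function.uncurry h (q.1.1, q.2)) q := by
    refine Measurable.indicator (hh.comp (by fun_prop)) ?_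
    exact (isOpen_coshBall_prod c).measurableSet.preimage
      ((measurable_snd.comp measurable_fst).prodMk measurable_snd)
  have h2 := hm.stronglyMeasurable.integral_prod_right' (ν := vol)
  convert h2.measurable.const_mul (vol.real (coshBall c (origin : Hyp n)))⁻¹ using 2 with q
  simp only [Function.uncurry, ballAverage]
  rw [← integral_indicator (isOpen_coshBall c q.2).measurableSet]
  rfl

theorem measurable_ballAverage_iterate {X : Type*} [MeasurableSpace X] (c : ℝ)
    {h : X → Hyp n → ℝ} (hh : Measurable (Function.uncurry h)) (k : ℕ) :
    Measurable (Function.uncurry fun P x => (ballAverage c)^[k] (h P) x) := by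
  induction k with
  | zero => exact hh
  | succ k ih =>
    simp only [Function.iterate_succ_apply']
    exact measurable_ballAverage c ih

theorem integrableOn_of_mem_Icc {f : Hyp n → ℝ} (hf : Measurable f) {a b : ℝ}
    (hab : ∀ x, f x ∈ Icc a b) {s : Set (Hyp n)} (hs : vol s ≠ ∞) : IntegrableOn f s vol := by
  have : IsFiniteMeasure (vol.restrict s) := ⟨by simpa using hs.lt_top⟩
  exact Integrable.of_mem_Icc a b hf.aemeasurable (ae_of_all _ hab)

/-- Doeblin's estimate: if the ball at `x` contains `U`, then the average at `x` differs from
a quantity that depends on `U` only by a definite fraction of the bounds of the function. -/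
theorem ballAverage_mem_Icc_of_subset (hn : 2 ≤ n) {c : ℝ} (hc : 1 < c) {f : Hyp n → ℝ}
    (hf : Measurable f) {a b : ℝ} (hab : ∀ x, f x ∈ Icc a b) {U : Set (Hyp n)}
    (hU : MeasurableSet U) {x : Hyp n} (hUx : U ⊆ coshBall c x) :
    ballAverage c f x ∈
      Icc ((vol.real (coshBall c (origin : Hyp n)))⁻¹ * ∫ y in U, f y ∂vol +
          (1 - vol.real U / vol.real (coshBall c (origin : Hyp n))) * a)
        ((vol.real (coshBall c (origin : Hyp n)))⁻¹ * ∫ y in U, f y ∂vol +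
          (1 - vol.real U / vol.real (coshBall c (origin : Hyp n))) * b) := by
  set V := vol.real (coshBall c (origin : Hyp n)) with hV
  have hVx : vol.real (coshBall c x) = V := by rw [hV, measureReal_def, vol_coshBall hn]; rfl
  have hV0 : 0 < V := by
    refine ENNReal.toReal_pos ?_ (vol_coshBall_ne_top hn c _)
    refine ((isOpen_coshBall c _).measure_pos vol ⟨origin, ?_⟩).ne'
    rw [mem_coshBall, origin.2.1]
    linarith
  have hi := integrableOn_of_mem_Icc hf hab (vol_coshBall_ne_top hn c x)
  have hsplit := setIntegral_sdiff hU hi hUx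
  have hfin : vol (coshBall c x \ U) ≠ ∞ :=
    measure_ne_top_of_subset sdiff_subset (vol_coshBall_ne_top hn c x)
  have hreal : vol.real (coshBall c x \ U) = V - vol.real U := by
    rw [measureReal_sdiff hUx hU (vol_coshBall_ne_top hn c x), hVx]
  have hm : MeasurableSet (coshBall c x \ U) := (isOpen_coshBall c x).measurableSet.diff hU
  have hlo := setIntegral_mono_on (integrableOn_const hfin) (hi.mono_set sdiff_subset) hm
    fun y _ => (hab y).1
  have hhi := setIntegral_mono_on (hi.mono_set sdiff_subset) (integrableOn_const hfin) hm
    fun y _ => (hab y).2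
  rw [setIntegral_const, smul_eq_mul, hreal, hsplit] at hlo hhi
  rw [ballAverage, ← hV, mem_Icc]
  constructor
  · rw [← mul_le_mul_iff_right₀ hV0]
    field_simp
    linarith
  · rw [← mul_le_mul_iff_right₀ hV0]
    field_simp
    linarith

theorem ballAverage_mem_Icc (hn : 2 ≤ n) {c : ℝ} (hc : 1 < c) {f : Hyp n → ℝ}
    (hf : Measurable f) {a b : ℝ} (hab : ∀ x, f x ∈ Icc a b) (x : Hyp n) :
    ballAverage c f x ∈ Icc a b := by
  simpa using ballAverage_mem_Icc_of_subset hn hc hf hab MeasurableSet.empty (empty_subset _)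
    (x := x)

theorem measurable_ballAverage_iterate_apply (c : ℝ) {f : Hyp n → ℝ} (hf : Measurable f) (k : ℕ) :
    Measurable ((ballAverage c)^[k] f) :=
  (measurable_ballAverage_iterate c (h := fun _ : Unit => f)
    (hf.comp measurable_snd) k).comp (measurable_prodMk_left (x := ()))

theorem ballAverage_iterate_mem_Icc (hn : 2 ≤ n) {c : ℝ} (hc : 1 < c) {f : Hyp n → ℝ}
    (hf : Measurable f) {a b : ℝ} (hab : ∀ x, f x ∈ Icc a b) (k : ℕ) (x : Hyp n) :
    (ballAverage c)^[k] f x ∈ Icc a b := by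
  induction k generalizing x with
  | zero => exact hab x
  | succ k ih =>
    rw [Function.iterate_succ_apply']
    exact ballAverage_mem_Icc hn hc (measurable_ballAverage_iterate_apply c hf k) ih x

theorem integral_ballAverage (hn : 2 ≤ n) {c : ℝ} (hc : 1 < c) {X : Type*} [MeasurableSpace X]
    {μ : Measure X} [IsFiniteMeasure μ] {h : X → Hyp n → ℝ} (hh : Measurable (Function.uncurry h))
    {a b : ℝ} (hab : ∀ P x, h P x ∈ Icc a b) {D : ℝ} (hD : ∀ x, ∫ P, h P x ∂μ = D) (x : Hyp n) :
    ∫ P, ballAverage c (h P) x ∂μ = D := by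
  have : IsFiniteMeasure (vol.restrict (coshBall c x)) :=
    ⟨by simpa using (vol_coshBall_ne_top hn c x).lt_top⟩
  have hV0 : vol.real (coshBall c x) ≠ 0 := by
    refine (ENNReal.toReal_pos ?_ (vol_coshBall_ne_top hn c _)).ne'
    refine ((isOpen_coshBall c _).measure_pos vol ⟨x, ?_⟩).ne'
    rw [mem_coshBall, x.2.1]
    linarith
  have hVx : vol.real (coshBall c (origin : Hyp n)) = vol.real (coshBall c x) := by
    rw [measureReal_def, ← vol_coshBall hn c x]
    rfl
  simp only [ballAverage]
  rw [integral_const_mul, integral_integral_swap (f := h)]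
  · simp only [hD]
    rw [setIntegral_const, smul_eq_mul, hVx, inv_mul_cancel_left₀ hV0]
  · exact Integrable.of_mem_Icc a b hh.aemeasurable (ae_of_all _ fun q => hab q.1 q.2)

theorem integral_ballAverage_iterate (hn : 2 ≤ n) {c : ℝ} (hc : 1 < c) {X : Type*}
    [MeasurableSpace X] {μ : Measure X} [IsFiniteMeasure μ] {h : X → Hyp n → ℝ}
    (hh : Measurable (Function.uncurry h)) {a b : ℝ} (hab : ∀ P x, h P x ∈ Icc a b) {D : ℝ}
    (hD : ∀ x, ∫ P, h P x ∂μ = D) (k : ℕ) (x : Hyp n) :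
    ∫ P, (ballAverage c)^[k] (h P) x ∂μ = D := by
  induction k generalizing x with
  | zero => exact hD x
  | succ k ih =>
    simp only [Function.iterate_succ_apply']
    exact integral_ballAverage hn hc (measurable_ballAverage_iterate c hh k)
      (fun P y => ballAverage_iterate_mem_Icc hn hc (hh.comp measurable_prodMk_left) (hab P) k y)
      ih x

/-! ### Ball averages of functions invariant under a group. -/

section Periodic

variable {Γ : Subgroup (IsomPlus n)}

/-- Let `x` receive `f y` from every `y` in its ball. Since `y ∈ coshBall c x` is a symmetric
relation, exchanging the roles of the points under mass transport over `F` leaves `f x` times the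
constant volume of a ball. -/
theorem setIntegral_ballAverage [Countable Γ] (hn : 2 ≤ n) {c : ℝ} (hc : 1 < c) {F : Set (Hyp n)}
    (hF : IsFundamentalDomain Γ F vol) {f : Hyp n → ℝ} (hf : Measurable f)
    {b : ℝ} (hab : ∀ x, f x ∈ Icc 0 b) (hinv : ∀ (g : Γ) x, f (g • x) = f x) :
    ∫ x in F, ballAverage c f x ∂vol = ∫ x in F, f x ∂vol := by
  have hm : Measurable (ballAverage c f) := measurable_ballAverage_iterate_apply c hf 1
  rw [integral_eq_lintegral_of_nonneg_ae
      (ae_of_all _ fun x => (ballAverage_mem_Icc hn hc hf hab x).1) hm.aestronglyMeasurable,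
    integral_eq_lintegral_of_nonneg_ae (ae_of_all _ fun x => (hab x).1) hf.aestronglyMeasurable]
  congr 1
  set V := vol (coshBall c (origin : Hyp n)) with hV
  have hVt : V ≠ ∞ := vol_coshBall_ne_top hn c origin
  have hV0 : V ≠ 0 := by
    refine ((isOpen_coshBall c _).measure_pos vol ⟨origin, ?_⟩).ne'
    rw [mem_coshBall, origin.2.1]
    linarith
  let K : Hyp n → Hyp n → ℝ≥0∞ := fun x y =>
    (coshBall c x).indicator (fun y => ENNReal.ofReal (f y)) y
  have hK : Measurable (Function.uncurry K) :=
    Measurable.indicator (f := fun q : Hyp n × Hyp n => ENNReal.ofReal (f q.2))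
      (hf.comp measurable_snd).ennreal_ofReal (isOpen_coshBall_prod c).measurableSet
  have hKinv : ∀ (g : Γ) x y, K (g • x) (g • y) = K x y := by
    intro g x y
    refine indicator_eq_indicator smul_mem_coshBall_smul ?_
    exact congrArg ENNReal.ofReal (hinv g y)
  have h1 : ∀ x, ENNReal.ofReal (ballAverage c f x) = V⁻¹ * ∫⁻ y, K x y ∂vol := by
    intro x
    rw [ballAverage, ENNReal.ofReal_mul (by positivity), measureReal_def, ← ENNReal.toReal_inv,
      ENNReal.ofReal_toReal (ENNReal.inv_ne_top.2 hV0), ofReal_integral_eq_lintegral_ofReal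
      (integrableOn_of_mem_Icc hf hab (vol_coshBall_ne_top hn c x))
      (ae_of_all _ fun x => (hab x).1), lintegral_indicator (isOpen_coshBall c x).measurableSet]
  have h2 : ∀ x, ∫⁻ y, K y x ∂vol = ENNReal.ofReal (f x) * V := by
    intro x
    have h3 : ∀ y, K y x = (coshBall c x).indicator (fun _ => ENNReal.ofReal (f x)) y := fun y =>
      indicator_eq_indicator mem_coshBall_comm rfl
    simp only [h3]
    rw [lintegral_indicator_const (isOpen_coshBall c x).measurableSet, vol_coshBall hn]
  simp only [h1]
  rw [lintegral_const_mul (f := fun x => ∫⁻ y, K x y ∂vol) _ hK.lintegral_prod_right',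
    hF.setLIntegral_lintegral_comm hK hKinv]
  simp only [h2]
  rw [lintegral_mul_const _ hf.ennreal_ofReal, mul_comm, mul_assoc, ENNReal.mul_inv_cancel hV0 hVt,
    mul_one]

theorem setIntegral_ballAverage_iterate [Countable Γ] (hn : 2 ≤ n) {c : ℝ} (hc : 1 < c)
    {F : Set (Hyp n)} (hF : IsFundamentalDomain Γ F vol) {f : Hyp n → ℝ} (hf : Measurable f)
    {b : ℝ} (hab : ∀ x, f x ∈ Icc 0 b) (hinv : ∀ (g : Γ) x, f (g • x) = f x) (k : ℕ) :
    ∫ x in F, (ballAverage c)^[k] f x ∂vol = ∫ x in F, f x ∂vol := by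
  induction k with
  | zero => rfl
  | succ k ih =>
    simp only [Function.iterate_succ_apply']
    rw [setIntegral_ballAverage hn hc hF (measurable_ballAverage_iterate_apply c hf k)
      (ballAverage_iterate_mem_Icc hn hc hf hab k) (fun g x => ?_), ih]
    exact (ballAverage_iterate_comp_smul c f g k x).symm.trans
      (congrArg (fun h => (ballAverage c)^[k] h x) (funext fun y => hinv g y))

/-- The iterated averages of a function invariant under a cocompact group converge uniformly
and geometrically to a constant. -/
theorem exists_forall_ballAverage_iterate_mem_Icc (hn : 2 ≤ n) {C : Set (Hyp n)} (hC : IsCompact C)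
    (hCΓ : ∀ x : Hyp n, ∃ g : Γ, g • x ∈ C) :
    ∃ c > 1, ∃ δ ∈ Ioc (0 : ℝ) 1, ∀ f : Hyp n → ℝ, Measurable f →
      (∀ (g : Γ) x, f (g • x) = f x) → (∀ x, f x ∈ Icc 0 1) → ∀ k : ℕ, ∃ a : ℝ,
        ∀ x, (ballAverage c)^[k] f x ∈ Icc a (a + (1 - δ) ^ k) := by
  set U := coshBall 2 (origin : Hyp n) with hU
  -- The radius is chosen so that the ball about every point of `C` contains the fixed ball `U`.
  obtain ⟨c₀, hc₀⟩ := ((hC.prod (isCompact_coshClosedBall (n := n) 2)).image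
    continuous_lorentz_val.neg).bddAbove
  set c := max c₀ 1 + 1 with hc
  have hc1 : 1 < c := by linarith [le_max_right c₀ 1]
  have hUc : ∀ x ∈ C, U ⊆ coshBall c x := by
    intro x hx y hy
    have h : -lorentz x.1 y.1 ≤ c₀ := hc₀ ⟨(x, y), ⟨hx, (mem_coshBall.1 hy).le⟩, rfl⟩
    rw [mem_coshBall]
    linarith [le_max_left c₀ 1]
  obtain ⟨g₀, hg₀⟩ := hCΓ origin
  have hU0 : 0 < vol.real U := by
    refine ENNReal.toReal_pos ?_ (vol_coshBall_ne_top hn 2 _)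
    refine ((isOpen_coshBall 2 _).measure_pos vol ⟨origin, ?_⟩).ne'
    rw [mem_coshBall, origin.2.1]
    norm_num
  have hUV : vol.real U ≤ vol.real (coshBall c (origin : Hyp n)) := by
    have h := measureReal_mono (hUc _ hg₀) (vol_coshBall_ne_top hn c _)
    rwa [measureReal_def vol (coshBall c _), vol_coshBall hn] at h
  refine ⟨c, hc1, vol.real U / vol.real (coshBall c (origin : Hyp n)),
    ⟨div_pos hU0 (hU0.trans_le hUV), div_le_one_of_le₀ hUV measureReal_nonneg⟩, ?_⟩
  intro f hf hinv h01 k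
  set δ := vol.real U / vol.real (coshBall c (origin : Hyp n)) with hδ
  induction k with
  | zero => exact ⟨0, fun x => by simpa using h01 x⟩
  | succ k ih =>
    obtain ⟨a, ha⟩ := ih
    -- This is the lower end of Doeblin's interval with common part `U`; the width shrinks by the
    -- factor `1 - δ`, the fraction of the ball outside `U`.
    refine ⟨(vol.real (coshBall c (origin : Hyp n)))⁻¹ * ∫ y in U, (ballAverage c)^[k] f y ∂vol +
      (1 - δ) * a, fun x => ?_⟩
    obtain ⟨g, hg⟩ := hCΓ x
    have hx : (ballAverage c)^[k + 1] f x = ballAverage c ((ballAverage c)^[k] f) (g • x) := by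
      rw [← Function.iterate_succ_apply' (ballAverage c) k f]
      refine Eq.trans ?_ (ballAverage_iterate_comp_smul c f g (k + 1) x)
      exact congrArg (fun h => (ballAverage c)^[k + 1] h x) (funext fun y => (hinv g y).symm)
    have h := ballAverage_mem_Icc_of_subset hn hc1 (measurable_ballAverage_iterate_apply c hf k) ha
      (isOpen_coshBall 2 (origin : Hyp n)).measurableSet (hUc _ hg)
    rw [hx]
    convert h using 2
    rw [pow_succ]
    ring

end Periodic

end Hyp

/-! ### The density of a periodic packing. -/

open Hyp in
/-- The average density of a measure carried by the orbit of a periodic packing is the density of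
that packing in a fundamental domain. -/
theorem averageDensity_eq_of_isPeriodic {S : SubMulAction (IsomPlus n) (Packing n)} {μ : Measure S}
    [IsProbabilityMeasure μ] [SMulInvariantMeasure (IsomPlus n) S μ] (hn : 2 ≤ n) {P : Packing n}
    (hP : P.IsPeriodic)
    (horbit : ∀ᵐ Q : S ∂μ, (Q : Packing n) ∈ MulAction.orbit (IsomPlus n) P)
    {F : Set (Hyp n)} (hF : IsFundamentalDomain P.symmetryGroup F vol) (hF0 : vol F ≠ 0) :
    averageDensity μ = vol.real (P.covered ∩ F) / vol.real F := by
  obtain ⟨C, hC, hCP⟩ := hP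
  have : Countable P.symmetryGroup := hF.countable_of_measure_ne_zero hF0
  have hFt : vol F ≠ ∞ :=
    ((hF.measure_le_of_forall_exists_smul_mem hCP).trans_lt hC.measure_lt_top).ne
  have hFr : 0 < vol.real F := ENNReal.toReal_pos hF0 hFt
  obtain ⟨c, hc, δ, hδ, hosc⟩ := exists_forall_ballAverage_iterate_mem_Icc hn hC hCP
  obtain ⟨f, hfdef⟩ : ∃ f : Packing n → Hyp n → ℝ, ∀ Q, f Q = Q.covered.indicator 1 :=
    ⟨_, fun _ => rfl⟩
  have hf : ∀ Q, Measurable (f Q) := by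
    intro Q
    rw [hfdef]
    exact measurable_one.indicator Q.measurableSet_covered
  have hf01 : ∀ Q x, f Q x ∈ Icc 0 1 := by
    intro Q x
    rw [hfdef]
    exact ⟨indicator_nonneg (fun _ _ => zero_le_one) x,
      indicator_le_self' (fun _ _ => zero_le_one) x⟩
  have hfsmul : ∀ (g : IsomPlus n) Q x, f (g • Q) (g • x) = f Q x := by
    intro g Q x
    rw [hfdef, hfdef]
    exact indicator_eq_indicator Packing.smul_mem_covered_smul rfl
  have hfinv : ∀ (g : P.symmetryGroup) x, f P (g • x) = f P x := by
    intro g x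
    rw [← hfsmul g P x, MulAction.mem_stabilizer_iff.1 g.2]
    rfl
  have hmean : ∫ x in F, f P x ∂vol = vol.real (P.covered ∩ F) := by
    rw [hfdef, integral_indicator_one P.measurableSet_covered, measureReal_restrict_apply
      P.measurableSet_covered]
  have hfu : Measurable (Function.uncurry fun Q : S => f Q) := by
    simp only [hfdef]
    exact measurable_one.indicator measurableSet_covered_prod
  have hD : ∀ x, ∫ Q : S, f Q x ∂μ = averageDensity μ := by
    intro x
    rw [averageDensity_eq_measure μ hn x, ← integral_indicator_one
      (measurableSet_setOf_mem_covered x)]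
    simp only [hfdef]
    rfl
  have hbound : ∀ k : ℕ, ∀ x, |(ballAverage c)^[k] (f P) x -
      vol.real (P.covered ∩ F) / vol.real F| ≤ (1 - δ) ^ k := by
    intro k x
    obtain ⟨a, ha⟩ := hosc (f P) (hf P) hfinv (hf01 P) k
    have hi := setIntegral_ballAverage_iterate hn hc hF (hf P) (hf01 P) hfinv k
    have hint := integrableOn_of_mem_Icc (measurable_ballAverage_iterate_apply c (hf P) k) ha hFt
    have hconst : ∀ r : ℝ, IntegrableOn (fun _ => r) F vol := fun r => integrableOn_const hFt
    -- The mean over `F` of the `k`-th average is still the density in `F`, so it lies in the same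
    -- short interval as every value.
    have hlo := setIntegral_mono (hconst _) hint fun y => (ha y).1
    have hhi := setIntegral_mono hint (hconst _) fun y => (ha y).2
    rw [setIntegral_const, smul_eq_mul, hi, hmean, mul_comm, ← le_div_iff₀ hFr] at hlo
    rw [setIntegral_const, smul_eq_mul, hi, hmean, mul_comm, ← div_le_iff₀ hFr] at hhi
    rw [abs_le]
    constructor <;> linarith [(ha x).1, (ha x).2]
  have hk : ∀ k : ℕ, |averageDensity μ - vol.real (P.covered ∩ F) / vol.real F| ≤ (1 - δ) ^ k := by
    intro k
    have hm : Measurable fun Q : S => (ballAverage c)^[k] (f Q) origin :=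
      (measurable_ballAverage_iterate c hfu k).of_uncurry_right
    have hint : Integrable (fun Q : S => (ballAverage c)^[k] (f Q) origin) μ :=
      Integrable.of_mem_Icc 0 1 hm.aemeasurable (ae_of_all _ fun Q =>
        ballAverage_iterate_mem_Icc hn hc (hf Q) (hf01 Q) k origin)
    have hsub : averageDensity μ - vol.real (P.covered ∩ F) / vol.real F =
        ∫ Q : S, ((ballAverage c)^[k] (f Q) origin - vol.real (P.covered ∩ F) / vol.real F) ∂μ := by
      rw [integral_sub hint (integrable_const _), integral_ballAverage_iterate hn hc hfu
        (fun Q => hf01 Q) hD k origin]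
      simp
    have hae : ∀ᵐ Q : S ∂μ, ‖(ballAverage c)^[k] (f Q) origin -
        vol.real (P.covered ∩ F) / vol.real F‖ ≤ (1 - δ) ^ k := by
      filter_upwards [horbit] with Q hQ
      obtain ⟨g, hg⟩ := hQ
      -- For `Q = g • P` the average at the origin is that of `P` at `g⁻¹ • origin`, where the
      -- uniform bound applies whatever `g` is.
      have hfQ : f Q = fun y => f P (g⁻¹ • y) := by
        funext y
        rw [← hfsmul g P, smul_inv_smul, ← hg]
      rw [hfQ, ballAverage_iterate_comp_smul, Real.norm_eq_abs]
      exact hbound k _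
    have h := norm_integral_le_of_norm_le_const hae
    rwa [← hsub, probReal_univ, mul_one, Real.norm_eq_abs] at h
  have hlim : Tendsto (fun k : ℕ => (1 - δ) ^ k) atTop (𝓝 0) :=
    tendsto_pow_atTop_nhds_zero_of_lt_one (by linarith [hδ.2]) (by linarith [hδ.1])
  have h0 := ge_of_tendsto' hlim hk
  exact sub_eq_zero.1 (abs_eq_zero.1 (le_antisymm h0 (abs_nonneg _)))

end HypPacking

end

theorem mainTheorem7 (n : ℕ) (hn : 2 ≤ n)
    (S : SubMulAction (HypPacking.IsomPlus n) (HypPacking.Packing n))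
    (μ : Measure S) [IsProbabilityMeasure μ]
    [SMulInvariantMeasure (HypPacking.IsomPlus n) S μ] :
    -- the density through an associated space of tilings
    (∀ φ : S → HypPacking.Packing n,
      Measurable φ →
      (∀ P : S, (φ P).IsTiling) →
      (∀ (g : HypPacking.IsomPlus n) (P : S), φ (g • P) = g • φ P) →
      (∀ᵐ P ∂μ, (φ P).bodies.Pairwise fun K L =>
        HypPacking.Hyp.vol ((K : Set (HypPacking.Hyp n)) ∩ (L : Set (HypPacking.Hyp n))) = 0) →
      ∀ (p : HypPacking.Hyp n) (τ : S → NonemptyCompacts (HypPacking.Hyp n)),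
        (∀ P : S, τ P ∈ (φ P).bodies ∧ p ∈ τ P) →
        Integrable (fun P : S =>
          HypPacking.Hyp.vol.real ((P : HypPacking.Packing n).covered ∩ (τ P : Set _)) /
            HypPacking.Hyp.vol.real (τ P : Set (HypPacking.Hyp n))) μ ∧
        HypPacking.averageDensity μ =
          ∫ P : S, HypPacking.Hyp.vol.real ((P : HypPacking.Packing n).covered ∩ (τ P : Set _)) /
            HypPacking.Hyp.vol.real (τ P : Set (HypPacking.Hyp n)) ∂μ) ∧
    -- periodic packings
    (∀ P : HypPacking.Packing n, P.IsPeriodic →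
      (∀ᵐ Q : S ∂μ, (Q : HypPacking.Packing n) ∈ MulAction.orbit (HypPacking.IsomPlus n) P) →
      ∀ F : Set (HypPacking.Hyp n),
        IsFundamentalDomain P.symmetryGroup F HypPacking.Hyp.vol →
        HypPacking.Hyp.vol F ≠ 0 →
        HypPacking.averageDensity μ =
          HypPacking.Hyp.vol.real (P.covered ∩ F) / HypPacking.Hyp.vol.real F) := by
  refine ⟨fun φ hφ _ hequiv hnull p τ hτ => ?_, fun P hP horbit F hF hF0 => ?_⟩
  · exact HypPacking.averageDensity_eq_integral_tile hn hφ hequiv hnull p τ hτ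
  · exact HypPacking.averageDensity_eq_of_isPeriodic hn hP horbit hF hF0
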